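/- **Setting.** Let $X_1,X_2,\ldots$ be i.i.d. random elements of a measurable space $\mathcal X$ with distribution $P_0$, and let $X\sim P_0$. For $k=1,\ldots,K$ let $\Theta_k\subseteq\mathbb R^{d_k}$ be open, let $\ell_k:\mathcal X\times\Theta_k\to\mathbb R$ be measurable, let $\theta_k^*\in\operatorname{argmin}_{\theta_k\in\Theta_k}\mathbb E\,\ell_k(X;\theta_k)$ be a fixed minimizer (assumed to exist), and let $\hat\theta_k=\hat\theta_k(X_1,\ldots,X_n)\in\Theta_k$ be an estimator. Put $$\Sigma^0=\operatorname{Cov}\big(\ell_1(X;\theta_1^*),\ldots,\ell_K(X;\theta_K^*)\big)\in\mathbb R^{K\times K}.$$ Let $\|\cdot\|$ denote the Euclidean norm of vectors and the Frobenius norm of matrices. **Condition 1.** (i) $\mathbb E\big(\ell_k(X;\theta_k^*)^2\big)<\infty$ for all $k$; (ii) $\Sigma^0$ is positive definite. **Condition 2.** For every $k$ there is $r>0$ such that the open ball $B_r(\theta_k^*)$ is contained in $\Theta_k$ and: (a) $\mathbb E|\ell_k(X;\theta_k)|<\infty$ for all $\theta_k\in B_r(\theta_k^*)$; (b) for all $x\in\mathcal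 X$, the map $\theta_k\mapsto\ell_k(x;\theta_k)$ is twice continuously differentiable on $B_r(\theta_k^*)$; (c) there is $H:\mathcal X\to[0,\infty)$ with $\mathbb E\,H(X)<\infty$ and $\sup_{\theta_k\in B_r(\theta_k^*)}\|\nabla^2_{\theta_k}\ell_k(x;\theta_k)\|\le H(x)$ for all $x\in\mathcal X$; (d) $\mathbb E\|\nabla_{\theta_k}\ell_k(X;\theta_k^*)\|^2<\infty$; (e) $\|\hat\theta_k-\theta_k^*\|=O_p(1/\sqrt n)$. **Posterior.** Fix $\mu_0\in\mathbb R^K$, $\lambda_0>0$, a positive definite $\Psi_0\in\mathbb R^{K\times K}$, and $\nu_0>K-1$. Let $\mathrm{NIW}(m,\lambda,\Psi,\nu)$ be the normal-inverse-Wishart distribution of $(\mu,\Sigma)$, with density $\mathcal N(\mu\mid m,\Sigma/\lambda)\,\mathrm{InverseWishart}(\Sigma\mid\Psi,\nu)$ for $\mu \in \mathbb R^K$ and $\Sigma$ positive definite, where $$\mathrm{InverseWishart}(\Sigma\mid\Psi,\nu)=\frac{|\Psi|^{\nu/2}}{2^{\nu K/2}\,\Gamma_K(\nu/2)}\,|\Sigma|^{-(\nu+K+1)/2}\,e^{-\frac12\operatorname{tr}(\Psi\Sigma^{-1})}$$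 and $\Gamma_K$ is the multivariate gamma function. For each $n\ge1$ put $Z_{ik}=\ell_k(X_i;\hat\theta_k)$, $Z_i=(Z_{i1},\ldots,Z_{iK})^{\mathsf T}$ for $i\le n$, $\overline Z_n=\frac1n\sum_{i=1}^nZ_i$, $S_n=\frac1n\sum_{i=1}^n(Z_i-\overline Z_n)(Z_i-\overline Z_n)^{\mathsf T}$, and $$\lambda_n=\lambda_0+n,\quad \mu_n=\frac{\lambda_0\mu_0+n\overline Z_n}{\lambda_n},\quad \nu_n=\nu_0+n,\quad \Psi_n=\Psi_0+nS_n+\frac{\lambda_0n}{\lambda_n}(\overline Z_n-\mu_0)(\overline Z_n-\mu_0)^{\mathsf T}.$$ **Theorem (posterior covariance consistency).** Assume Conditions 1 and 2, and for each $n\ge 1$ let $(\mu'_n,\Sigma'_n)$ be a random pair whose conditional distribution given $Z_1,\ldots,Z_n$ is $\mathrm{NIW}(\mu_n,\lambda_n,\Psi_n,\nu_n)$. Then $\Sigma'_n\to\Sigma^0$ in probability as $n\to\infty$, jointly over the data and the posterior draw; that is, for every $\varepsilon>0$, $\mathbb P\big(\|\Sigma'_n-\Sigma^0\|\ge\varepsilon\big)\to0$.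 -/

import Mathlib

open MeasureTheory ProbabilityTheory Filter Topology

/-! ### Matrices: sigma-algebra and Frobenius norm -/

/-- The (Borel) product sigma-algebra on real matrices. -/
instance instMeasurableSpaceRealMatrix {m n : Type*} : MeasurableSpace (Matrix m n ℝ) :=
  inferInstanceAs (MeasurableSpace (m → n → ℝ))

instance instStandardBorelSpaceRealMatrix {m n : Type*} [Countable m] [Countable n] :
    StandardBorelSpace (Matrix m n ℝ) :=
  inferInstanceAs (StandardBorelSpace (m → n → ℝ))

/-- The Frobenius norm of a real matrix. -/
noncomputable def frobNorm {m n : Type*} [Fintype m] [Fintype n] (A : Matrix m n ℝ) : ℝ :=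
  Real.sqrt (∑ i, ∑ j, A i j ^ 2)

/-! ### Normal, inverse-Wishart and normal-inverse-Wishart distributions -/

/-- Lebesgue measure on the space of real symmetric `K × K` matrices, `∏_{i ≤ j} dΣ_{ij}`, viewed as
a measure on all `K × K` matrices. The coordinates are indexed by unordered pairs `{i, j}`. -/
noncomputable def symLebesgue (K : ℕ) : Measure (Matrix (Fin K) (Fin K) ℝ) :=
  (volume : Measure (Sym2 (Fin K) → ℝ)).map (fun v => Matrix.of fun i j => v s(i, j))

/-- The multivariate gamma function
`Γ_K(a) = π^{K(K-1)/4} ∏_{j=1}^{K} Γ(a + (1 - j)/2)` (here `j` runs from `0`). -/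
noncomputable def multivariateGamma (K : ℕ) (a : ℝ) : ℝ :=
  Real.pi ^ ((K : ℝ) * ((K : ℝ) - 1) / 4) * ∏ j : Fin K, Real.Gamma (a - (j : ℝ) / 2)

/-- The density `𝒩(x ∣ m, S)` of the multivariate normal distribution. -/
noncomputable def normalDensity {K : ℕ} (m : Fin K → ℝ) (S : Matrix (Fin K) (Fin K) ℝ)
    (x : Fin K → ℝ) : ℝ :=
  (2 * Real.pi) ^ (-(K : ℝ) / 2) * S.det ^ (-(1 / 2) : ℝ) *
    Real.exp (-(1 / 2) * ((x - m) ⬝ᵥ (S⁻¹.mulVec (x - m))))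

/-- The density `InverseWishart(S ∣ Ψ, ν)` at a positive definite matrix `S`. -/
noncomputable def inverseWishartDensity {K : ℕ} (Psi : Matrix (Fin K) (Fin K) ℝ) (nu : ℝ)
    (S : Matrix (Fin K) (Fin K) ℝ) : ℝ :=
  Psi.det ^ (nu / 2) / (2 ^ (nu * K / 2) * multivariateGamma K (nu / 2)) *
    S.det ^ (-(nu + K + 1) / 2) * Real.exp (-(1 / 2) * (Psi * S⁻¹).trace)

/-- The normal-inverse-Wishart distribution of a pair `(μ, Σ)`: it lives on positive definite `Σ`
and has density `𝒩(μ ∣ m, Σ/λ) · InverseWishart(Σ ∣ Ψ, ν)` with respect to Lebesgue measure. -/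
noncomputable def niw {K : ℕ} (m : Fin K → ℝ) (lam : ℝ) (Psi : Matrix (Fin K) (Fin K) ℝ) (nu : ℝ) :
    Measure ((Fin K → ℝ) × Matrix (Fin K) (Fin K) ℝ) :=
  ((volume : Measure (Fin K → ℝ)).prod (symLebesgue K)).withDensity
    ({p | p.2.PosDef}.indicator fun p =>
      ENNReal.ofReal (normalDensity m (lam⁻¹ • p.2) p.1 * inverseWishartDensity Psi nu p.2))

/-! ### Sample moments and the posterior -/

/-- The sample mean `Z̄_n`. -/
noncomputable def sampleMean {K n : ℕ} (z : Fin n → Fin K → ℝ) : Fin K → ℝ :=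
  (n : ℝ)⁻¹ • ∑ i, z i

/-- The sample covariance `S_n = (1/n) ∑ (Z_i - Z̄_n)(Z_i - Z̄_n)ᵀ`. -/
noncomputable def sampleCov {K n : ℕ} (z : Fin n → Fin K → ℝ) : Matrix (Fin K) (Fin K) ℝ :=
  (n : ℝ)⁻¹ • ∑ i, Matrix.vecMulVec (z i - sampleMean z) (z i - sampleMean z)

/-- The posterior `NIW(μ_n, λ_n, Ψ_n, ν_n)` of `(μ, Σ)` given data `z = (Z_1, …, Z_n)`, for the prior
`NIW(m0, lam0, Psi0, nu0)`. -/
noncomputable def niwPosterior {K : ℕ} (m0 : Fin K → ℝ) (lam0 : ℝ)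
    (Psi0 : Matrix (Fin K) (Fin K) ℝ) (nu0 : ℝ) {n : ℕ} (z : Fin n → Fin K → ℝ) :
    Measure ((Fin K → ℝ) × Matrix (Fin K) (Fin K) ℝ) :=
  niw ((lam0 + n)⁻¹ • (lam0 • m0 + (n : ℝ) • sampleMean z))
    (lam0 + n)
    (Psi0 + (n : ℝ) • sampleCov z +
      (lam0 * n / (lam0 + n)) • Matrix.vecMulVec (sampleMean z - m0) (sampleMean z - m0))
    (nu0 + n)

/-! ### Conditions on the loss functions and estimators -/

/-- The expectation `E(f) = E(f⁺) - E(f⁻)` with values in `[-∞, ∞]`. -/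
noncomputable def extExpectation {𝒳 : Type*} [MeasurableSpace 𝒳] (P₀ : Measure 𝒳) (f : 𝒳 → ℝ) :
    EReal :=
  ((∫⁻ x, ENNReal.ofReal (f x) ∂P₀ : ENNReal) : EReal) -
    ((∫⁻ x, ENNReal.ofReal (-f x) ∂P₀ : ENNReal) : EReal)

/-- The expectation of `f` exists in `[-∞, ∞]`: it is not of the form `∞ - ∞`. -/
def HasExtExpectation {𝒳 : Type*} [MeasurableSpace 𝒳] (P₀ : Measure 𝒳) (f : 𝒳 → ℝ) : Prop :=
  ∫⁻ x, ENNReal.ofReal (f x) ∂P₀ ≠ ⊤ ∨ ∫⁻ x, ENNReal.ofReal (-f x) ∂P₀ ≠ ⊤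

/-- The set of minimizers over `Θ` of the expected loss `θ ↦ E(ℓ(X; θ))`. -/
def argminExpectedLoss {𝒳 : Type*} [MeasurableSpace 𝒳] (P₀ : Measure 𝒳) {d : ℕ}
    (Θ : Set (EuclideanSpace ℝ (Fin d))) (ℓ : 𝒳 → EuclideanSpace ℝ (Fin d) → ℝ) :
    Set (EuclideanSpace ℝ (Fin d)) :=
  {t | t ∈ Θ ∧ HasExtExpectation P₀ (fun x => ℓ x t) ∧
    ∀ t' ∈ Θ, HasExtExpectation P₀ (fun x => ℓ x t') →
      extExpectation P₀ (fun x => ℓ x t) ≤ extExpectation P₀ (fun x => ℓ x t')}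

/-- The Hessian matrix of `f : ℝᵈ → ℝ` at `t`. -/
noncomputable def hessianMatrix {d : ℕ} (f : EuclideanSpace ℝ (Fin d) → ℝ)
    (t : EuclideanSpace ℝ (Fin d)) : Matrix (Fin d) (Fin d) ℝ :=
  Matrix.of fun i j =>
    iteratedFDeriv ℝ 2 f t ![EuclideanSpace.single i 1, EuclideanSpace.single j 1]

/-- `Y_n = O_p(a_n)`. -/
def IsBigOInProb {Ω : Type*} [MeasurableSpace Ω] (P : Measure Ω) (Y : ℕ → Ω → ℝ) (a : ℕ → ℝ) :
    Prop :=
  ∀ δ : ENNReal, 0 < δ → ∃ M : ℝ, ∀ᶠ n in atTop, P {ω | M * a n < |Y n ω|} < δ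

/-- The regularity conditions on one model: parameter space `Θ`, loss `ℓ`, population minimizer
`tstar`, and estimators `that n` computed from a sample of size `n`. Only the values of `ℓ x` on `Θ`
are relevant. -/
structure ModelRegularity {𝒳 Ω : Type*} [MeasurableSpace 𝒳] [MeasurableSpace Ω]
    (P : Measure Ω) (P₀ : Measure 𝒳) (X : ℕ → Ω → 𝒳) {d : ℕ}
    (Θ : Set (EuclideanSpace ℝ (Fin d))) (ℓ : 𝒳 → EuclideanSpace ℝ (Fin d) → ℝ)
    (tstar : EuclideanSpace ℝ (Fin d))
    (that : (n : ℕ) → (Fin n → 𝒳) → EuclideanSpace ℝ (Fin d)) : Prop where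
  isOpen : IsOpen Θ
  measurable_loss : Measurable fun p : 𝒳 × Θ => ℓ p.1 p.2
  mem_argmin : tstar ∈ argminExpectedLoss P₀ Θ ℓ
  local_regularity : ∃ r > 0, Metric.ball tstar r ⊆ Θ ∧
    (∀ t ∈ Metric.ball tstar r, Integrable (fun x => ℓ x t) P₀) ∧
    (∀ x, ContDiffOn ℝ 2 (ℓ x) (Metric.ball tstar r)) ∧
    (∃ H : 𝒳 → ℝ, (∀ x, 0 ≤ H x) ∧ Integrable H P₀ ∧
      ∀ x, ∀ t ∈ Metric.ball tstar r, frobNorm (hessianMatrix (ℓ x) t) ≤ H x)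
  gradient_sq_integrable : Integrable (fun x => ‖gradient (ℓ x) tstar‖ ^ 2) P₀
  measurable_estimator : ∀ n, Measurable (that n)
  estimator_mem : ∀ n x, that n x ∈ Θ
  estimator_rate :
    IsBigOInProb P (fun n ω => ‖that n (fun i => X i ω) - tstar‖) (fun n => 1 / Real.sqrt n)

/-- The LaD vectors `Z_1, …, Z_n ∈ ℝᴷ`, `Z_{ik} = ℓ_k(X_i; θ̂_k(X_1, …, X_n))`, as a function of the
sample `x = (X_1, …, X_n)`. -/
def ladVectors {𝒳 : Type*} {K : ℕ} {d : Fin K → ℕ}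
    (ℓ : (k : Fin K) → 𝒳 → EuclideanSpace ℝ (Fin (d k)) → ℝ)
    (that : (k : Fin K) → (n : ℕ) → (Fin n → 𝒳) → EuclideanSpace ℝ (Fin (d k)))
    {n : ℕ} (x : Fin n → 𝒳) : Fin n → Fin K → ℝ :=
  fun i k => ℓ k (x i) (that k n x)

/-- The true LaD covariance `Σ⁰ = Cov(ℓ(X; θ*))`, `X ∼ P₀`. -/
noncomputable def ladCovariance {𝒳 : Type*} [MeasurableSpace 𝒳] (P₀ : Measure 𝒳) {K : ℕ}
    {d : Fin K → ℕ} (ℓ : (k : Fin K) → 𝒳 → EuclideanSpace ℝ (Fin (d k)) → ℝ)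
    (tstar : (k : Fin K) → EuclideanSpace ℝ (Fin (d k))) : Matrix (Fin K) (Fin K) ℝ :=
  Matrix.of fun j k => cov[fun x => ℓ j x (tstar j), fun x => ℓ k x (tstar k); P₀]

/-! Write `Ψ_n` and `ν_n` for the posterior parameters. The draw satisfies `vᵀ Σ'⁻¹ v ≈ ν_n · vᵀ
Ψ_n⁻¹ v` for each fixed `v`, so `Σ'` is close to `Ψ_n / ν_n`, and the latter converges to `Σ⁰`.

Concentration: under an NIW law of total mass one, `vᵀ Σ⁻¹ v / vᵀ Ψ⁻¹ v` has the Laplace transform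
of a chi-square variable with `ν` degrees of freedom (`lintegral_exp_quadForm_niw`). Tilting by
`exp(-s vᵀΣ⁻¹v / 2)` replaces `Ψ` by `Ψ + s v vᵀ = A Ψ Aᵀ`, and a congruence does not change the
total mass (`niw_congr_univ`). The normalising constant is never evaluated: total mass one holds
because the posterior is a conditional distribution. Chernoff's bound then gives a rate `exp(-cν)`
uniform in `Ψ` (`exists_niw_concentration`), hence valid for the random `Ψ_n`.

Limit of `Ψ_n / ν_n`: the prior terms are negligible. Replacing `θ̂_k` by `θ_k*` costs an average
squared error tending to zero (`tendsto_average_sq_loss_sub`), and the strong law handles the losses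
at `θ_k*`.

The two inputs hold in probability and the strong law almost surely; passing to subsequences
(`tendstoInMeasure_of_forall_filter`) makes the rest a deterministic limit, where finitely many
vectors `e_i + e_j` determine `Σ'⁻¹`. -/

/-! ### Jacobian of `S ↦ A S Aᵀ` on symmetric matrices -/

/-- The symmetric matrix with given entries at the unordered pairs of indices. -/
def symMatrix {K : ℕ} (v : Sym2 (Fin K) → ℝ) : Matrix (Fin K) (Fin K) ℝ :=
  Matrix.of fun i j => v s(i, j)

theorem symMatrix_injective {K : ℕ} : Function.Injective (symMatrix (K := K)) := by
  intro v w h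
  funext z
  induction z with
  | _ i j => exact congrFun (congrFun h i) j

theorem measurable_symMatrix {K : ℕ} : Measurable (symMatrix (K := K)) :=
  measurable_pi_lambda _ fun _ => measurable_pi_lambda _ fun _ => measurable_pi_apply _

/-- The map `S ↦ A S Aᵀ` in the coordinates of symmetric matrices. -/
def symCongr {K : ℕ} (A : Matrix (Fin K) (Fin K) ℝ) :
    (Sym2 (Fin K) → ℝ) →ₗ[ℝ] (Sym2 (Fin K) → ℝ) where
  toFun v := Sym2.lift ⟨fun i j => ∑ a, ∑ b, A i a * A j b * v s(a, b), fun i j => by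
    refine Finset.sum_comm.trans ?_
    refine Finset.sum_congr rfl fun a _ => Finset.sum_congr rfl fun b _ => ?_
    rw [Sym2.eq_swap]; ring⟩
  map_add' v w := by
    funext z
    induction z with
    | _ i j => simp [mul_add, Finset.sum_add_distrib]
  map_smul' c v := by
    funext z
    induction z with
    | _ i j =>
      simp only [Sym2.lift_mk, Pi.smul_apply, smul_eq_mul, RingHom.id_apply, Finset.mul_sum]
      exact Finset.sum_congr rfl fun a _ => Finset.sum_congr rfl fun b _ => by ring

theorem symMatrix_symCongr {K : ℕ} (A : Matrix (Fin K) (Fin K) ℝ) (v : Sym2 (Fin K) → ℝ) :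
    symMatrix (symCongr A v) = A * symMatrix v * A.transpose := by
  ext i j
  simp only [symMatrix, symCongr, LinearMap.coe_mk, AddHom.coe_mk, Matrix.of_apply, Sym2.lift_mk,
    Matrix.mul_apply, Matrix.transpose_apply, Finset.sum_mul]
  rw [Finset.sum_comm]
  exact Finset.sum_congr rfl fun a _ => Finset.sum_congr rfl fun b _ => by ring

theorem symCongr_mul {K : ℕ} (A B : Matrix (Fin K) (Fin K) ℝ) :
    symCongr (A * B) = symCongr A ∘ₗ symCongr B := by
  refine LinearMap.ext fun v => symMatrix_injective ?_
  simp [symMatrix_symCongr, Matrix.mul_assoc, Matrix.transpose_mul]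

theorem symCongr_one {K : ℕ} : symCongr (1 : Matrix (Fin K) (Fin K) ℝ) = LinearMap.id := by
  refine LinearMap.ext fun v => symMatrix_injective ?_
  simp [symMatrix_symCongr]

theorem det_symCongr_mul {K : ℕ} (A B : Matrix (Fin K) (Fin K) ℝ) :
    LinearMap.det (symCongr (A * B)) = LinearMap.det (symCongr A) * LinearMap.det (symCongr B) := by
  rw [symCongr_mul, LinearMap.det_comp]

/-- These products are the eigenvalues of `S ↦ D S D`. Sorting each pair lets the smaller and the
larger entries be counted separately. -/
theorem prod_sym2_mul {K : ℕ} (D : Fin K → ℝ) :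
    ∏ z : Sym2 (Fin K), Sym2.lift ⟨fun i j => D i * D j, fun _ _ => mul_comm _ _⟩ z =
      (∏ i, D i) ^ (K + 1) := by
  rw [← (Sym2.sortEquiv (α := Fin K)).symm.prod_comp]
  have h1 : ∀ p : {p : Fin K × Fin K // p.1 ≤ p.2},
      Sym2.lift ⟨fun i j => D i * D j, fun i j => mul_comm _ _⟩ (Sym2.sortEquiv.symm p) =
        D p.1.1 * D p.1.2 := fun p => rfl
  rw [Finset.prod_congr rfl fun p _ => h1 p, Finset.prod_mul_distrib]
  have h2 : ∀ f : Fin K × Fin K → ℝ, ∏ p : {p : Fin K × Fin K // p.1 ≤ p.2}, f p.1 =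
      ∏ i, ∏ j, if i ≤ j then f (i, j) else 1 := by
    intro f
    rw [← Fintype.prod_prod_type', ← Finset.prod_filter (fun p : Fin K × Fin K => p.1 ≤ p.2) f]
    exact (Finset.prod_subtype _ (by simp) f).symm
  rw [h2 fun p => D p.1, h2 fun p => D p.2,
    Finset.prod_comm (f := fun i j => if i ≤ j then D (i, j).2 else 1), ← Finset.prod_mul_distrib,
    ← Finset.prod_pow]
  refine Finset.prod_congr rfl fun i _ => ?_
  simp only [← Finset.prod_filter, Finset.prod_const, ← pow_add]
  congr 1
  have e1 : (Finset.univ.filter fun j => i ≤ j) = Finset.Ici i := by ext; simp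
  have e2 : (Finset.univ.filter fun j => j ≤ i) = Finset.Iic i := by ext; simp
  -- The index `i` is the smaller entry of `K - i` pairs and the larger of `i + 1`; the pair `{i,
  -- i}` counts in both.
  rw [e1, e2, Fin.card_Ici, Fin.card_Iic]
  omega

theorem det_symCongr_diagonal {K : ℕ} (D : Fin K → ℝ) :
    LinearMap.det (symCongr (Matrix.diagonal D)) = (∏ i, D i) ^ (K + 1) := by
  have h : symCongr (Matrix.diagonal D) = Matrix.toLin' (Matrix.diagonal
      (Sym2.lift ⟨fun i j => D i * D j, fun i j => mul_comm _ _⟩)) := by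
    refine LinearMap.ext fun v => symMatrix_injective ?_
    rw [symMatrix_symCongr]
    ext i j
    rw [Matrix.diagonal_transpose, Matrix.mul_diagonal, Matrix.diagonal_mul]
    simp [symMatrix, Matrix.mulVec_diagonal]
    ring
  rw [h, LinearMap.det_toLin', Matrix.det_diagonal, prod_sym2_mul]

/-- A transvection `T` is conjugate to its square through a diagonal matrix `D` doubling coordinate
`i`. The determinant is multiplicative, so the value at `T` is nonzero and equal to its own square.
-/
theorem det_symCongr_transvection {K : ℕ} (t : Matrix.TransvectionStruct (Fin K) ℝ) :
    LinearMap.det (symCongr t.toMatrix) = 1 := by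
  obtain ⟨i, j, hij, c⟩ := t
  simp only [Matrix.TransvectionStruct.toMatrix_mk]
  set T := fun c : ℝ => Matrix.transvection i j c
  set D : Matrix (Fin K) (Fin K) ℝ := Matrix.diagonal fun k => if k = i then 2 else 1
  have hTT : T c * T c = T (2 * c) := by
    simp only [T]
    rw [Matrix.transvection_mul_transvection_same _ _ hij, two_mul]
  have hDT : D * T c = T (2 * c) * D := by
    simp only [T, D, Matrix.transvection, mul_add, add_mul, mul_one, one_mul]
    congr 1
    ext a b
    rw [Matrix.diagonal_mul, Matrix.mul_diagonal, Matrix.single_apply, Matrix.single_apply]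
    by_cases h : i = a ∧ j = b
    · obtain ⟨rfl, rfl⟩ := h
      simp [hij.symm]
    · simp [h]
  have hD : LinearMap.det (symCongr D) ≠ 0 := by
    rw [det_symCongr_diagonal]
    refine pow_ne_zero _ (Finset.prod_ne_zero_iff.2 fun k _ => ?_)
    split_ifs <;> norm_num
  have hT : LinearMap.det (symCongr (T c)) ≠ 0 := by
    have h : T c * T (-c) = 1 := by
      simp only [T]
      rw [Matrix.transvection_mul_transvection_same _ _ hij, add_neg_cancel, Matrix.transvection_zero]
    have := det_symCongr_mul (T c) (T (-c))
    rw [h, symCongr_one, LinearMap.det_id] at this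
    exact left_ne_zero_of_mul (this ▸ one_ne_zero)
  have h := congrArg (fun M => LinearMap.det (symCongr M)) hDT
  simp only [det_symCongr_mul, ← hTT] at h
  have h' : LinearMap.det (symCongr (T c)) * (LinearMap.det (symCongr D) *
      (LinearMap.det (symCongr (T c)) - 1)) = 0 := by linear_combination -h
  simpa [hT, hD, sub_eq_zero] using h'

/-- Both sides are multiplicative, so diagonal matrices and transvections suffice. -/
theorem det_symCongr {K : ℕ} {A : Matrix (Fin K) (Fin K) ℝ} (hA : A.det ≠ 0) :
    LinearMap.det (symCongr A) = A.det ^ (K + 1) := by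
  refine Matrix.diagonal_transvection_induction_of_det_ne_zero
    (fun A => LinearMap.det (symCongr A) = A.det ^ (K + 1)) A hA (fun D _ => ?_) (fun t => ?_)
    (fun A B _ _ hA hB => ?_)
  · rw [det_symCongr_diagonal, Matrix.det_diagonal]
  · rw [det_symCongr_transvection, Matrix.TransvectionStruct.det, one_pow]
  · rw [det_symCongr_mul, hA, hB, Matrix.det_mul, mul_pow]

theorem measurable_congr_matrix {K : ℕ} (A : Matrix (Fin K) (Fin K) ℝ) :
    Measurable fun S : Matrix (Fin K) (Fin K) ℝ => A * S * A.transpose := by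
  refine measurable_pi_lambda _ fun i => measurable_pi_lambda _ fun j => ?_
  simp only [Matrix.mul_apply]
  have h : ∀ a b, Measurable fun S : Matrix (Fin K) (Fin K) ℝ => S a b := fun a b =>
    (measurable_pi_apply b).comp (measurable_pi_apply a)
  exact Finset.measurable_sum _ fun a _ =>
    (Finset.measurable_sum _ fun b _ => (h b a).const_mul _).mul_const _

theorem map_symLebesgue_congr {K : ℕ} {A : Matrix (Fin K) (Fin K) ℝ} (hA : 0 < A.det) :
    (symLebesgue K).map (fun S => A * S * A.transpose) =
      ENNReal.ofReal ((A.det ^ (K + 1))⁻¹) • symLebesgue K := by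
  change ((volume : Measure (Sym2 (Fin K) → ℝ)).map symMatrix).map _ =
    _ • (volume : Measure (Sym2 (Fin K) → ℝ)).map symMatrix
  have hdet : LinearMap.det (symCongr A) ≠ 0 := by
    rw [det_symCongr hA.ne']; positivity
  rw [Measure.map_map (measurable_congr_matrix A) measurable_symMatrix]
  have h : (fun S => A * S * A.transpose) ∘ symMatrix = symMatrix ∘ symCongr A :=
    funext fun v => (symMatrix_symCongr A v).symm
  rw [h, ← Measure.map_map measurable_symMatrix
    (LinearMap.continuous_of_finiteDimensional _).measurable,
    Measure.map_linearMap_addHaar_eq_smul_addHaar _ hdet, Measure.map_smul, det_symCongr hA.ne',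
    abs_of_pos (by positivity)]

theorem map_volume_affine {K : ℕ} {A : Matrix (Fin K) (Fin K) ℝ} (hA : 0 < A.det) (c : Fin K → ℝ) :
    (volume : Measure (Fin K → ℝ)).map (fun x => A.mulVec x + c) =
      ENNReal.ofReal (A.det⁻¹) • volume := by
  have h : (fun x => A.mulVec x + c) = (fun x => x + c) ∘ Matrix.toLin' A := by
    funext x; simp
  rw [h, ← Measure.map_map (measurable_add_const c)
    (LinearMap.continuous_of_finiteDimensional _).measurable,
    Real.map_matrix_volume_pi_eq_smul_volume_pi hA.ne', Measure.map_smul, map_add_right_eq_self,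
    abs_of_pos (inv_pos.2 hA)]

/-! ### Measurability and the NIW density -/

instance instBorelSpaceRealMatrix {m n : Type*} [Countable m] [Countable n] :
    BorelSpace (Matrix m n ℝ) :=
  inferInstanceAs (BorelSpace (m → n → ℝ))

theorem measurable_matrix {α m n : Type*} [MeasurableSpace α] {f : α → Matrix m n ℝ}
    (h : ∀ i j, Measurable fun x => f x i j) : Measurable f :=
  measurable_pi_lambda _ fun i => measurable_pi_lambda _ fun j => h i j

theorem measurable_matrix_apply {m n : Type*} (i : m) (j : n) :
    Measurable fun S : Matrix m n ℝ => S i j :=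
  (measurable_pi_apply j).comp (measurable_pi_apply i)

theorem measurable_matrix_det {n : Type*} [Fintype n] [DecidableEq n] :
    Measurable fun S : Matrix n n ℝ => S.det :=
  (Continuous.matrix_det continuous_id).measurable

theorem measurable_matrix_inv {n : Type*} [Fintype n] [DecidableEq n] :
    Measurable fun S : Matrix n n ℝ => S⁻¹ := by
  refine measurable_matrix fun i j => ?_
  simp only [Matrix.inv_def, Ring.inverse_eq_inv', Matrix.smul_apply, smul_eq_mul]
  exact measurable_matrix_det.inv.mul ((measurable_matrix_apply i j).comp
    (Continuous.matrix_adjugate continuous_id).measurable)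

theorem measurable_inv_quadForm {n : Type*} [Fintype n] [DecidableEq n] (v : n → ℝ) :
    Measurable fun S : Matrix n n ℝ => v ⬝ᵥ (S⁻¹.mulVec v) := by
  simp only [dotProduct, Matrix.mulVec]
  exact Finset.measurable_sum _ fun i _ => (Finset.measurable_sum _ fun j _ =>
    (((measurable_matrix_apply i j).comp measurable_matrix_inv)).mul_const _).const_mul _

theorem isClosed_posSemidef {n : Type*} [Fintype n] :
    IsClosed {S : Matrix n n ℝ | S.PosSemidef} := by
  simp only [Matrix.posSemidef_iff_dotProduct_mulVec, Set.ofPred_and, Set.ofPred_forall]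
  refine IsClosed.inter ?_ (isClosed_iInter fun x => ?_)
  · exact isClosed_eq (Continuous.matrix_conjTranspose continuous_id) continuous_id
  · exact isClosed_le continuous_const
      (Continuous.dotProduct continuous_const (Continuous.matrix_mulVec continuous_id
        continuous_const))

theorem measurableSet_posDef {n : Type*} [Fintype n] :
    MeasurableSet {S : Matrix n n ℝ | S.PosDef} := by
  classical
  have h : {S : Matrix n n ℝ | S.PosDef} = {S | S.PosSemidef} ∩ {S | S.det = 0}ᶜ := by
    ext S
    exact ⟨fun h => ⟨h.posSemidef, h.posSemidef.posDef_iff_det_ne_zero.1 h⟩,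
      fun h => h.1.posDef_iff_det_ne_zero.2 h.2⟩
  rw [h]
  exact isClosed_posSemidef.measurableSet.inter
    (measurable_matrix_det (measurableSet_singleton 0)).compl

/-- The density of the normal-inverse-Wishart distribution. -/
noncomputable def niwDensity {K : ℕ} (m : Fin K → ℝ) (lam : ℝ) (Psi : Matrix (Fin K) (Fin K) ℝ)
    (nu : ℝ) : (Fin K → ℝ) × Matrix (Fin K) (Fin K) ℝ → ENNReal :=
  {p | p.2.PosDef}.indicator fun p =>
    ENNReal.ofReal (normalDensity m (lam⁻¹ • p.2) p.1 * inverseWishartDensity Psi nu p.2)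

theorem niwDensity_of_posDef {K : ℕ} (m : Fin K → ℝ) (lam : ℝ) (Psi : Matrix (Fin K) (Fin K) ℝ)
    (nu : ℝ) {p : (Fin K → ℝ) × Matrix (Fin K) (Fin K) ℝ} (hp : p.2.PosDef) :
    niwDensity m lam Psi nu p = ENNReal.ofReal
      (normalDensity m (lam⁻¹ • p.2) p.1 * inverseWishartDensity Psi nu p.2) := by
  simp [niwDensity, hp]

theorem niwDensity_of_not_posDef {K : ℕ} (m : Fin K → ℝ) (lam : ℝ)
    (Psi : Matrix (Fin K) (Fin K) ℝ) (nu : ℝ) {p : (Fin K → ℝ) × Matrix (Fin K) (Fin K) ℝ}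
    (hp : ¬ p.2.PosDef) : niwDensity m lam Psi nu p = 0 := by
  simp [niwDensity, hp]

theorem niw_eq_withDensity {K : ℕ} (m : Fin K → ℝ) (lam : ℝ) (Psi : Matrix (Fin K) (Fin K) ℝ)
    (nu : ℝ) : niw m lam Psi nu =
      ((volume : Measure (Fin K → ℝ)).prod (symLebesgue K)).withDensity
        (niwDensity m lam Psi nu) := rfl

theorem measurable_normalDensity {K : ℕ} (m : Fin K → ℝ) (lam : ℝ) :
    Measurable fun p : (Fin K → ℝ) × Matrix (Fin K) (Fin K) ℝ =>
      normalDensity m (lam⁻¹ • p.2) p.1 := by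
  have hs : Measurable fun p : (Fin K → ℝ) × Matrix (Fin K) (Fin K) ℝ => lam⁻¹ • p.2 :=
    measurable_matrix fun i j => ((measurable_matrix_apply i j).comp measurable_snd).const_mul _
  have hx : ∀ i, Measurable fun p : (Fin K → ℝ) × Matrix (Fin K) (Fin K) ℝ => (p.1 - m) i :=
    fun i => ((measurable_pi_apply i).comp measurable_fst).sub_const _
  refine (((measurable_matrix_det.comp hs).pow_const _).const_mul _).mul
    (Measurable.exp (Measurable.const_mul ?_ _))
  simp only [dotProduct, Matrix.mulVec]
  exact Finset.measurable_sum _ fun i _ => (hx i).mul (Finset.measurable_sum _ fun j _ =>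
    ((measurable_matrix_apply i j).comp (measurable_matrix_inv.comp hs)).mul (hx j))

theorem measurable_inverseWishartDensity {K : ℕ} (Psi : Matrix (Fin K) (Fin K) ℝ) (nu : ℝ) :
    Measurable (inverseWishartDensity Psi nu) := by
  refine ((measurable_matrix_det.pow_const _).const_mul _).mul
    (Measurable.exp (Measurable.const_mul ?_ _))
  simp only [Matrix.trace, Matrix.diag, Matrix.mul_apply]
  exact Finset.measurable_sum _ fun i _ => Finset.measurable_sum _ fun j _ =>
    ((measurable_matrix_apply j i).comp measurable_matrix_inv).const_mul _

theorem measurable_niwDensity {K : ℕ} (m : Fin K → ℝ) (lam : ℝ) (Psi : Matrix (Fin K) (Fin K) ℝ)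
    (nu : ℝ) : Measurable (niwDensity m lam Psi nu) :=
  (((measurable_normalDensity m lam).mul
    ((measurable_inverseWishartDensity Psi nu).comp measurable_snd)).ennreal_ofReal).indicator
    (measurable_snd measurableSet_posDef)

theorem ae_niw_posDef {K : ℕ} (m : Fin K → ℝ) (lam : ℝ) (Psi : Matrix (Fin K) (Fin K) ℝ)
    (nu : ℝ) : ∀ᵐ p ∂niw m lam Psi nu, p.2.PosDef := by
  rw [niw_eq_withDensity, ae_withDensity_iff (measurable_niwDensity m lam Psi nu)]
  refine Eventually.of_forall fun p hp => ?_
  by_contra h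
  exact hp (niwDensity_of_not_posDef m lam Psi nu h)

/-! ### Congruence invariance of the NIW total mass -/

theorem posDef_congr_iff {K : ℕ} {A S : Matrix (Fin K) (Fin K) ℝ} (hA : 0 < A.det) :
    (A * S * A.transpose).PosDef ↔ S.PosDef := by
  have hU : IsUnit A := (Matrix.isUnit_iff_isUnit_det A).2 hA.ne'.isUnit
  simpa [Matrix.star_eq_conjTranspose] using Matrix.IsUnit.posDef_star_right_conjugate_iff hU (x := S)

theorem normalDensity_congr {K : ℕ} {A S : Matrix (Fin K) (Fin K) ℝ} (hA : 0 < A.det)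
    (hS : 0 < S.det) (m x : Fin K → ℝ) :
    normalDensity m (A * S * A.transpose) (A.mulVec x + (m - A.mulVec m)) =
      (A.det)⁻¹ * normalDensity m S x := by
  have h1 : A.mulVec x + (m - A.mulVec m) - m = A.mulVec (x - m) := by
    rw [Matrix.mulVec_sub]; abel
  have hU : IsUnit A.det := hA.ne'.isUnit
  have h2 : (A.mulVec (x - m)) ⬝ᵥ ((A * S * A.transpose)⁻¹.mulVec (A.mulVec (x - m))) =
      (x - m) ⬝ᵥ (S⁻¹.mulVec (x - m)) := by
    rw [Matrix.mul_inv_rev, Matrix.mul_inv_rev, Matrix.mulVec_mulVec, Matrix.mul_assoc,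
      Matrix.mul_assoc, Matrix.nonsing_inv_mul _ hU, Matrix.mul_one, ← Matrix.mulVec_mulVec,
      Matrix.dotProduct_mulVec, ← Matrix.transpose_nonsing_inv, Matrix.vecMul_transpose,
      Matrix.mulVec_mulVec, Matrix.nonsing_inv_mul _ hU, Matrix.one_mulVec]
  have h3 : (A * S * A.transpose).det ^ (-(1 / 2) : ℝ) = A.det⁻¹ * S.det ^ (-(1 / 2) : ℝ) := by
    rw [Matrix.det_mul, Matrix.det_mul, Matrix.det_transpose,
      show A.det * S.det * A.det = A.det ^ (2 : ℝ) * S.det by rw [Real.rpow_two]; ring,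
      Real.mul_rpow (by positivity) hS.le, ← Real.rpow_mul hA.le, ← Real.rpow_neg_one]
    norm_num
  rw [normalDensity, normalDensity, h1, h2, h3]
  ring

/-- The trace is invariant by cyclicity. `|Ψ|^(ν/2)` contributes `|A|^ν` and the power of `|S|`
contributes `|A|^(-(ν+K+1))`. -/
theorem inverseWishartDensity_congr {K : ℕ} {A Psi S : Matrix (Fin K) (Fin K) ℝ} (hA : 0 < A.det)
    (hPsi : 0 < Psi.det) (hS : 0 < S.det) (nu : ℝ) :
    inverseWishartDensity (A * Psi * A.transpose) nu (A * S * A.transpose) =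
      (A.det ^ (K + 1))⁻¹ * inverseWishartDensity Psi nu S := by
  have hU : IsUnit A.det := hA.ne'.isUnit
  have h0 : ∀ B : Matrix (Fin K) (Fin K) ℝ, (A * B * A.transpose).det = A.det ^ (2 : ℝ) * B.det :=
    fun B => by rw [Matrix.det_mul, Matrix.det_mul, Matrix.det_transpose, Real.rpow_two]; ring
  have h1 : (A * Psi * A.transpose * (A * S * A.transpose)⁻¹).trace = (Psi * S⁻¹).trace := by
    have hT : IsUnit A.transpose.det := by rwa [Matrix.det_transpose]
    have : A * Psi * A.transpose * (A * S * A.transpose)⁻¹ = A * (Psi * S⁻¹) * A⁻¹ := by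
      rw [Matrix.mul_inv_rev, Matrix.mul_inv_rev]
      simp only [Matrix.mul_assoc]
      rw [Matrix.mul_nonsing_inv_cancel_left _ _ hT]
    rw [this, Matrix.trace_mul_comm, ← Matrix.mul_assoc, Matrix.nonsing_inv_mul _ hU,
      Matrix.one_mul]
  have h2 : (A.det ^ (2 : ℝ)) ^ (nu / 2) * (A.det ^ (2 : ℝ)) ^ (-(nu + K + 1) / 2) =
      (A.det ^ (K + 1))⁻¹ := by
    rw [← Real.rpow_mul hA.le, ← Real.rpow_mul hA.le, ← Real.rpow_add hA, ← Real.rpow_natCast,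
      ← Real.rpow_neg hA.le]
    congr 1
    push_cast
    ring
  rw [inverseWishartDensity, inverseWishartDensity, h0, h0, h1, ← h2,
    Real.mul_rpow (by positivity) hS.le, Real.mul_rpow (by positivity) hPsi.le]
  ring

theorem niwDensity_congr {K : ℕ} {A Psi : Matrix (Fin K) (Fin K) ℝ} (hA : 0 < A.det)
    (hPsi : 0 < Psi.det) (m : Fin K → ℝ) {lam : ℝ} (hlam : 0 < lam) (nu : ℝ)
    (p : (Fin K → ℝ) × Matrix (Fin K) (Fin K) ℝ) :
    niwDensity m lam (A * Psi * A.transpose) nu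
        (A.mulVec p.1 + (m - A.mulVec m), A * p.2 * A.transpose) =
      ENNReal.ofReal (A.det⁻¹ * (A.det ^ (K + 1))⁻¹) * niwDensity m lam Psi nu p := by
  by_cases hp : p.2.PosDef
  · have hp' := (posDef_congr_iff hA).2 hp
    rw [niwDensity_of_posDef _ _ _ _ hp', niwDensity_of_posDef _ _ _ _ hp, ← ENNReal.ofReal_mul (by positivity)]
    have h : lam⁻¹ • (A * p.2 * A.transpose) = A * (lam⁻¹ • p.2) * A.transpose := by simp
    have hd : 0 < (lam⁻¹ • p.2).det := (hp.smul (inv_pos.2 hlam)).det_pos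
    simp only [h, normalDensity_congr hA hd, inverseWishartDensity_congr hA hPsi hp.det_pos]
    congr 1
    ring
  · have hp' := fun h => hp ((posDef_congr_iff hA).1 h)
    rw [niwDensity_of_not_posDef _ _ _ _ hp', niwDensity_of_not_posDef _ _ _ _ hp, mul_zero]

instance instSFiniteSymLebesgue {K : ℕ} : SFinite (symLebesgue K) :=
  inferInstanceAs (SFinite (Measure.map _ _))

/-- Change of variables by `(x, S) ↦ (A x + (m - A m), A S Aᵀ)`, which fixes the centre `m`. The
base measure and the density are multiplied by the same power of `|A|`, which cancels. -/
theorem niw_congr_univ {K : ℕ} {A Psi : Matrix (Fin K) (Fin K) ℝ} (hA : 0 < A.det)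
    (hPsi : 0 < Psi.det) (m : Fin K → ℝ) {lam : ℝ} (hlam : 0 < lam) (nu : ℝ) :
    niw m lam (A * Psi * A.transpose) nu Set.univ = niw m lam Psi nu Set.univ := by
  set g : (Fin K → ℝ) × Matrix (Fin K) (Fin K) ℝ → (Fin K → ℝ) × Matrix (Fin K) (Fin K) ℝ :=
    Prod.map (fun x => A.mulVec x + (m - A.mulVec m)) (fun S => A * S * A.transpose)
  have hg1 : Measurable fun x => A.mulVec x + (m - A.mulVec m) :=
    ((Continuous.matrix_mulVec continuous_const continuous_id).add continuous_const).measurable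
  have hg : Measurable g := hg1.prodMap (measurable_congr_matrix A)
  have hmap : ((volume : Measure (Fin K → ℝ)).prod (symLebesgue K)).map g =
      ENNReal.ofReal (A.det⁻¹ * (A.det ^ (K + 1))⁻¹) •
        (volume : Measure (Fin K → ℝ)).prod (symLebesgue K) := by
    rw [← Measure.map_prod_map _ _ hg1 (measurable_congr_matrix A), map_volume_affine hA,
      map_symLebesgue_congr hA, Measure.prod_smul_left, Measure.prod_smul_right, smul_smul,
      ENNReal.ofReal_mul (by positivity)]
  have h := lintegral_map (μ := (volume : Measure (Fin K → ℝ)).prod (symLebesgue K))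
    (measurable_niwDensity m lam (A * Psi * A.transpose) nu) hg
  rw [hmap, lintegral_smul_measure] at h
  have h' : ∀ p, niwDensity m lam (A * Psi * A.transpose) nu (g p) = _ :=
    fun p => niwDensity_congr hA hPsi m hlam nu p
  simp only [h'] at h
  rw [lintegral_const_mul _ (measurable_niwDensity m lam Psi nu), smul_eq_mul,
    ENNReal.mul_right_inj (ENNReal.ofReal_pos.2 (by positivity)).ne' ENNReal.ofReal_ne_top] at h
  rw [niw_eq_withDensity, niw_eq_withDensity, withDensity_apply _ MeasurableSet.univ,
    withDensity_apply _ MeasurableSet.univ, Measure.restrict_univ, h]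

/-! ### Laplace transform and concentration of `vᵀ Σ⁻¹ v` -/

/-- With `u = Ψ⁻¹ v` and `q = vᵀ u`, the matrix `A = 1 + c v uᵀ` has `det A = 1 + c q` and `A Ψ Aᵀ =
Ψ + (2c + c² q) v vᵀ`. The root of `2c + c² q = s` with `1 + c q > 0` is taken; negative `s` is
allowed, as the upper tail requires. -/
theorem exists_congr_eq_add_vecMulVec {K : ℕ} {Psi : Matrix (Fin K) (Fin K) ℝ} (hPsi : Psi.PosDef)
    {v : Fin K → ℝ} (hv : v ≠ 0) {s : ℝ} (hs : 0 < 1 + s * (v ⬝ᵥ (Psi⁻¹.mulVec v))) :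
    ∃ A : Matrix (Fin K) (Fin K) ℝ, 0 < A.det ∧
      A.det ^ 2 = 1 + s * (v ⬝ᵥ (Psi⁻¹.mulVec v)) ∧
      A * Psi * A.transpose = Psi + s • Matrix.vecMulVec v v := by
  set u := Psi⁻¹.mulVec v
  set q := v ⬝ᵥ u
  have hq : 0 < q := by simpa using hPsi.inv.dotProduct_mulVec_pos hv
  have hU : IsUnit Psi.det := hPsi.det_pos.ne'.isUnit
  have hu : Psi.mulVec u = v := by
    simp only [u]
    rw [Matrix.mulVec_mulVec, Matrix.mul_nonsing_inv _ hU, Matrix.one_mulVec]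
  have hu' : Matrix.vecMul u Psi = v := by
    have hT : Psi.transpose = Psi := by simpa using hPsi.isHermitian.eq
    rw [← Matrix.mulVec_transpose, hT, hu]
  set c := (Real.sqrt (1 + s * q) - 1) / q
  have hcq : 1 + c * q = Real.sqrt (1 + s * q) := by
    simp only [c]; field_simp; ring
  have hdet : (1 + c • Matrix.vecMulVec v u).det = Real.sqrt (1 + s * q) := by
    rw [← Matrix.smul_vecMulVec, Matrix.vecMulVec_eq Unit,
      Matrix.det_one_add_replicateCol_mul_replicateRow, dotProduct_smul, dotProduct_comm, ← hcq]
    rfl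
  have hsq : Real.sqrt (1 + s * q) ^ 2 = 1 + s * q := Real.sq_sqrt hs.le
  refine ⟨1 + c • Matrix.vecMulVec v u, hdet ▸ Real.sqrt_pos.2 hs, by rw [hdet, hsq], ?_⟩
  have h2 : 2 * c + c ^ 2 * q = s := by
    have : q * (2 * c + c ^ 2 * q - s) = 0 := by
      rw [← hcq] at hsq
      linear_combination hsq
    have := (mul_eq_zero.1 this).resolve_left hq.ne'
    linarith
  rw [add_mul, one_mul, Matrix.smul_mul, Matrix.vecMulVec_mul, hu', Matrix.transpose_add,
    Matrix.transpose_one, Matrix.transpose_smul, Matrix.transpose_vecMulVec, mul_add, mul_one,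
    Matrix.mul_smul, add_mul, Matrix.mul_vecMulVec, hu, Matrix.smul_mul,
    Matrix.vecMulVec_mul_vecMulVec, ← h2]
  ext i j
  simp only [Matrix.add_apply, Matrix.smul_apply, smul_eq_mul, Matrix.vecMulVec_apply,
    Pi.smul_apply, q]
  ring

/-- The exponential merges with `exp(-tr(ΨΣ⁻¹)/2)` into the density with scale `Ψ + s v vᵀ`. Only
the ratio of the powers `|·|^(ν/2)` of the two scales is left over. -/
theorem lintegral_exp_quadForm_niw {K : ℕ} {Psi : Matrix (Fin K) (Fin K) ℝ} (hPsi : Psi.PosDef)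
    (m : Fin K → ℝ) {lam : ℝ} (hlam : 0 < lam) (nu : ℝ) {v : Fin K → ℝ} (hv : v ≠ 0) {s : ℝ}
    (hs : 0 < 1 + s * (v ⬝ᵥ (Psi⁻¹.mulVec v))) :
    ∫⁻ p, ENNReal.ofReal (Real.exp (-(1 / 2) * (s * (v ⬝ᵥ (p.2⁻¹.mulVec v))))) ∂niw m lam Psi nu =
      ENNReal.ofReal ((1 + s * (v ⬝ᵥ (Psi⁻¹.mulVec v))) ^ (-(nu / 2))) *
        niw m lam Psi nu Set.univ := by
  obtain ⟨A, hA, hdet, hcong⟩ := exists_congr_eq_add_vecMulVec hPsi hv hs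
  set r := 1 + s * (v ⬝ᵥ (Psi⁻¹.mulVec v))
  have hdet' : (Psi + s • Matrix.vecMulVec v v).det = r * Psi.det := by
    rw [← hcong, Matrix.det_mul, Matrix.det_mul, Matrix.det_transpose, ← hdet]; ring
  have hf : Measurable fun p : (Fin K → ℝ) × Matrix (Fin K) (Fin K) ℝ =>
      ENNReal.ofReal (Real.exp (-(1 / 2) * (s * (v ⬝ᵥ (p.2⁻¹.mulVec v))))) :=
    (((((measurable_inv_quadForm v).comp measurable_snd).const_mul s).const_mul _).exp).ennreal_ofReal
  rw [← niw_congr_univ hA hPsi.det_pos m hlam nu, hcong, niw_eq_withDensity, niw_eq_withDensity,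
    lintegral_withDensity_eq_lintegral_mul _ (measurable_niwDensity m lam Psi nu) hf,
    withDensity_apply _ MeasurableSet.univ, Measure.restrict_univ,
    ← lintegral_const_mul _ (measurable_niwDensity m lam _ nu)]
  refine lintegral_congr fun p => ?_
  by_cases hp : p.2.PosDef
  · have htr : ((Psi + s • Matrix.vecMulVec v v) * p.2⁻¹).trace =
        (Psi * p.2⁻¹).trace + s * (v ⬝ᵥ (p.2⁻¹.mulVec v)) := by
      rw [add_mul, Matrix.trace_add, Matrix.smul_mul, Matrix.trace_smul, Matrix.vecMulVec_mul,
        Matrix.trace_vecMulVec, smul_eq_mul, Matrix.dotProduct_mulVec, dotProduct_comm]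
    have hr : r ^ (-(nu / 2)) * (r * Psi.det) ^ (nu / 2) = Psi.det ^ (nu / 2) := by
      rw [Real.mul_rpow hs.le hPsi.det_pos.le, ← mul_assoc, ← Real.rpow_add hs, neg_add_cancel,
        Real.rpow_zero, one_mul]
    rw [Pi.mul_apply, niwDensity_of_posDef _ _ _ _ hp, niwDensity_of_posDef _ _ _ _ hp,
      ← ENNReal.ofReal_mul' (Real.exp_pos _).le, ← ENNReal.ofReal_mul (by positivity),
      inverseWishartDensity, inverseWishartDensity, htr, hdet', ← hr, mul_add, Real.exp_add]
    congr 1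
    ring
  · rw [Pi.mul_apply, niwDensity_of_not_posDef _ _ _ _ hp, niwDensity_of_not_posDef _ _ _ _ hp,
      zero_mul, mul_zero]

/-- Markov's inequality for the tilted exponential with `s = t / q`. A positive `t` bounds the lower
tail, a negative `t` the upper one. -/
theorem niw_chernoff {K : ℕ} {Psi : Matrix (Fin K) (Fin K) ℝ} (hPsi : Psi.PosDef)
    (m : Fin K → ℝ) {lam : ℝ} (hlam : 0 < lam) (nu : ℝ) {v : Fin K → ℝ} (hv : v ≠ 0)
    (hprob : niw m lam Psi nu Set.univ = 1) {t : ℝ} (ht : 0 < 1 + t) (a : ℝ) :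
    niw m lam Psi nu {p | t * (v ⬝ᵥ (p.2⁻¹.mulVec v)) ≤ a * nu * (v ⬝ᵥ (Psi⁻¹.mulVec v))} ≤
      ENNReal.ofReal (Real.exp (-(1 / 2 * (Real.log (1 + t) - a)) * nu)) := by
  set q := v ⬝ᵥ (Psi⁻¹.mulVec v)
  have hq : 0 < q := by simpa using hPsi.inv.dotProduct_mulVec_pos hv
  have hs : 1 + t / q * q = 1 + t := by field_simp
  have h := lintegral_exp_quadForm_niw hPsi m hlam nu hv (s := t / q) (by rwa [hs])
  rw [hs, hprob, mul_one] at h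
  have hf : Measurable fun p : (Fin K → ℝ) × Matrix (Fin K) (Fin K) ℝ =>
      ENNReal.ofReal (Real.exp (-(1 / 2) * (t / q * (v ⬝ᵥ (p.2⁻¹.mulVec v))))) :=
    (((((measurable_inv_quadForm v).comp measurable_snd).const_mul _).const_mul _).exp).ennreal_ofReal
  have hm := mul_meas_ge_le_lintegral (μ := niw m lam Psi nu) hf
    (ENNReal.ofReal (Real.exp (-(1 / 2) * (a * nu))))
  rw [h] at hm
  have hsub : {p : (Fin K → ℝ) × Matrix (Fin K) (Fin K) ℝ |
      t * (v ⬝ᵥ (p.2⁻¹.mulVec v)) ≤ a * nu * q} ⊆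
      {p | ENNReal.ofReal (Real.exp (-(1 / 2) * (a * nu))) ≤
        ENNReal.ofReal (Real.exp (-(1 / 2) * (t / q * (v ⬝ᵥ (p.2⁻¹.mulVec v)))))} := by
    intro p hp
    refine ENNReal.ofReal_le_ofReal (Real.exp_le_exp.2 ?_)
    have : t / q * (v ⬝ᵥ (p.2⁻¹.mulVec v)) ≤ a * nu := by
      rw [div_mul_eq_mul_div, div_le_iff₀ hq]; exact hp
    linarith
  refine (measure_mono hsub).trans ?_
  rw [← ENNReal.mul_le_mul_iff_right (ENNReal.ofReal_pos.2 (Real.exp_pos _)).ne'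
    ENNReal.ofReal_ne_top]
  refine hm.trans (le_of_eq ?_)
  rw [← ENNReal.ofReal_mul (Real.exp_pos _).le, ← Real.exp_add, Real.rpow_def_of_pos ht]
  congr 2
  ring

theorem exists_niw_concentration {ε : ℝ} (hε : 0 < ε) : ∃ c > 0, ∀ (K : ℕ)
    (Psi : Matrix (Fin K) (Fin K) ℝ) (m : Fin K → ℝ) (lam nu : ℝ) (v : Fin K → ℝ), Psi.PosDef →
    0 < lam → 0 < nu → v ≠ 0 → niw m lam Psi nu Set.univ = 1 →
    niw m lam Psi nu
        {p | ε ≤ |(v ⬝ᵥ (p.2⁻¹.mulVec v)) / (nu * (v ⬝ᵥ (Psi⁻¹.mulVec v))) - 1|} ≤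
      ENNReal.ofReal (2 * Real.exp (-c * nu)) := by
  -- The upper tail uses the tilt `t = -θ`, chosen so that `1 - θ = (1 + ε/2)⁻¹`; the lower tail
  -- uses `t = ε`. Both exponents are positive by `log x ≥ 1 - x⁻¹`.
  set θ := ε / 2 / (1 + ε / 2) with hθ
  have h1 : 1 + -θ = (1 + ε / 2)⁻¹ := by rw [hθ]; field_simp; ring
  have h1' : 0 < 1 + -θ := by rw [h1]; positivity
  set c₁ := 1 / 2 * (Real.log (1 + -θ) - (-θ * (1 + ε)))
  set c₂ := 1 / 2 * (Real.log (1 + ε) - ε * (1 - ε))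
  have hc₁ : 0 < c₁ := by
    have h2 := Real.one_sub_inv_le_log_of_pos h1'
    rw [h1, inv_inv, ← h1] at h2
    have h3 : ε / 2 < θ * (1 + ε) := by
      rw [hθ, div_mul_eq_mul_div, lt_div_iff₀ (by positivity)]
      nlinarith
    simp only [c₁]
    linarith
  have hc₂ : 0 < c₂ := by
    have h2 := Real.one_sub_inv_le_log_of_pos (show 0 < 1 + ε by linarith)
    have h3 : ε * (1 - ε) < 1 - (1 + ε)⁻¹ := by
      rw [show 1 - (1 + ε)⁻¹ = ε / (1 + ε) by field_simp; ring, lt_div_iff₀ (by positivity)]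
      nlinarith [pow_pos hε 3]
    simp only [c₂]
    linarith
  refine ⟨min c₁ c₂, lt_min hc₁ hc₂, fun K Psi m lam nu v hPsi hlam hnu hv hprob => ?_⟩
  have hq : 0 < v ⬝ᵥ (Psi⁻¹.mulVec v) := by simpa using hPsi.inv.dotProduct_mulVec_pos hv
  set q := v ⬝ᵥ (Psi⁻¹.mulVec v)
  have hθ0 : 0 < θ := by positivity
  have hsub : {p : (Fin K → ℝ) × Matrix (Fin K) (Fin K) ℝ |
      ε ≤ |(v ⬝ᵥ (p.2⁻¹.mulVec v)) / (nu * q) - 1|} ⊆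
      {p | -θ * (v ⬝ᵥ (p.2⁻¹.mulVec v)) ≤ (-θ * (1 + ε)) * nu * q} ∪
      {p | ε * (v ⬝ᵥ (p.2⁻¹.mulVec v)) ≤ (ε * (1 - ε)) * nu * q} := by
    intro p hp
    have hp' : ε ≤ |(v ⬝ᵥ (p.2⁻¹.mulVec v)) / (nu * q) - 1| := hp
    have hpos : 0 < nu * q := by positivity
    rcases le_abs.1 hp' with h | h
    · left
      have h2 : (1 + ε) * (nu * q) ≤ v ⬝ᵥ (p.2⁻¹.mulVec v) := by
        rw [← le_div_iff₀ hpos]; linarith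
      change -θ * (v ⬝ᵥ (p.2⁻¹.mulVec v)) ≤ (-θ * (1 + ε)) * nu * q
      nlinarith [mul_le_mul_of_nonneg_left h2 hθ0.le]
    · right
      have h2 : v ⬝ᵥ (p.2⁻¹.mulVec v) ≤ (1 - ε) * (nu * q) := by
        rw [← div_le_iff₀ hpos]; linarith
      change ε * (v ⬝ᵥ (p.2⁻¹.mulVec v)) ≤ (ε * (1 - ε)) * nu * q
      nlinarith [mul_le_mul_of_nonneg_left h2 hε.le]
  have hexp : ∀ c, min c₁ c₂ ≤ c → ENNReal.ofReal (Real.exp (-c * nu)) ≤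
      ENNReal.ofReal (Real.exp (-min c₁ c₂ * nu)) := fun c hc =>
    ENNReal.ofReal_le_ofReal (Real.exp_le_exp.2
      (mul_le_mul_of_nonneg_right (neg_le_neg hc) hnu.le))
  refine (measure_mono hsub).trans ((measure_union_le _ _).trans ?_)
  rw [two_mul, ENNReal.ofReal_add (Real.exp_pos _).le (Real.exp_pos _).le]
  exact add_le_add
    ((niw_chernoff hPsi m hlam nu hv hprob h1' _).trans (hexp _ (min_le_left _ _)))
    ((niw_chernoff hPsi m hlam nu hv hprob (by linarith) _).trans (hexp _ (min_le_right _ _)))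

/-! ### Local Taylor bound for the loss -/

/-- Cauchy–Schwarz over pairs of coordinates. -/
theorem norm_bilin_le_frobNorm {d : ℕ}
    (L : EuclideanSpace ℝ (Fin d) →L[ℝ] EuclideanSpace ℝ (Fin d) →L[ℝ] ℝ) :
    ‖L‖ ≤ frobNorm (Matrix.of fun i j =>
      L (EuclideanSpace.single i 1) (EuclideanSpace.single j 1)) := by
  set M := Matrix.of fun i j => L (EuclideanSpace.single i 1) (EuclideanSpace.single j 1)
  have hsum : ∀ u : EuclideanSpace ℝ (Fin d), u = ∑ i, u i • EuclideanSpace.single i (1 : ℝ) := by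
    intro u
    simpa using ((EuclideanSpace.basisFun (Fin d) ℝ).sum_repr u).symm
  have hL : ∀ u w, L u w = ∑ i, ∑ j, (u i * w j) * M i j := by
    intro u w
    conv_lhs => rw [hsum u, hsum w]
    simp only [map_sum, map_smul, _root_.sum_apply, _root_.smul_apply,
      smul_eq_mul]
    rw [Finset.sum_comm]
    refine Finset.sum_congr rfl fun i _ => ?_
    rw [Finset.mul_sum]
    exact Finset.sum_congr rfl fun j _ => by simp only [M, Matrix.of_apply]; ring
  have hM : 0 ≤ frobNorm M := Real.sqrt_nonneg _
  refine L.opNorm_le_bound hM fun u => (L u).opNorm_le_bound (by positivity) fun w => ?_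
  rw [Real.norm_eq_abs]
  refine abs_le_of_sq_le_sq ?_ (by positivity)
  rw [hL, mul_pow, mul_pow, EuclideanSpace.norm_sq_eq, EuclideanSpace.norm_sq_eq, frobNorm,
    Real.sq_sqrt (by positivity)]
  have h := Finset.sum_mul_sq_le_sq_mul_sq (Finset.univ : Finset (Fin d × Fin d))
    (fun p => u p.1 * w p.2) (fun p => M p.1 p.2)
  simp only [Fintype.sum_prod_type] at h
  refine h.trans (le_of_eq ?_)
  simp only [mul_pow, Real.norm_eq_abs, sq_abs]
  rw [← Finset.sum_mul_sum]
  ring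

/-- The mean value inequality, applied to the derivative and then to `f` on the segment. It gives
`H` in place of Taylor's `H / 2`, which suffices here. -/
theorem abs_sub_le_of_hessian_le {d : ℕ} {f : EuclideanSpace ℝ (Fin d) → ℝ}
    {t₀ : EuclideanSpace ℝ (Fin d)} {r H : ℝ} (hf : ContDiffOn ℝ 2 f (Metric.ball t₀ r))
    (hH : ∀ t ∈ Metric.ball t₀ r, frobNorm (hessianMatrix f t) ≤ H)
    {t : EuclideanSpace ℝ (Fin d)} (ht : t ∈ Metric.ball t₀ r) :
    |f t - f t₀| ≤ (‖gradient f t₀‖ + H * ‖t - t₀‖) * ‖t - t₀‖ := by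
  have hr : 0 < r := Metric.pos_of_mem_ball ht
  have h0 : t₀ ∈ Metric.ball t₀ r := Metric.mem_ball_self hr
  have hH0 : 0 ≤ H := (Real.sqrt_nonneg _).trans (hH t₀ h0)
  have hd : ∀ x ∈ Metric.ball t₀ r, ContDiffAt ℝ 2 f x := fun x hx =>
    hf.contDiffAt (Metric.isOpen_ball.mem_nhds hx)
  have hd1 : ∀ x ∈ Metric.ball t₀ r, DifferentiableAt ℝ f x := fun x hx =>
    (hd x hx).differentiableAt (by norm_num)
  have hd2 : ∀ x ∈ Metric.ball t₀ r, DifferentiableAt ℝ (fderiv ℝ f) x := fun x hx =>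
    ((hd x hx).fderiv_right (m := 1) (by norm_num)).differentiableAt (by norm_num)
  have hb : ∀ x ∈ Metric.ball t₀ r, ‖fderiv ℝ (fderiv ℝ f) x‖ ≤ H := fun x hx => by
    refine (norm_bilin_le_frobNorm _).trans ((le_of_eq ?_).trans (hH x hx))
    congr 1
    ext i j
    simp [hessianMatrix, iteratedFDeriv_two_apply]
  have hlip : ∀ x ∈ Metric.ball t₀ r, ‖fderiv ℝ f x - fderiv ℝ f t₀‖ ≤ H * ‖x - t₀‖ :=
    fun x hx => (convex_ball t₀ r).norm_image_sub_le_of_norm_fderiv_le hd2 hb h0 hx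
  have hgrad : ‖fderiv ℝ f t₀‖ = ‖gradient f t₀‖ := by
    rw [gradient, LinearIsometryEquiv.norm_map]
  have hsub : segment ℝ t₀ t ⊆ Metric.ball t₀ r := (convex_ball t₀ r).segment_subset h0 ht
  have hseg : ∀ x ∈ segment ℝ t₀ t, ‖fderiv ℝ f x‖ ≤ ‖gradient f t₀‖ + H * ‖t - t₀‖ := by
    intro x hx
    have h1 := norm_sub_le_of_mem_segment hx
    have h2 := hlip x (hsub hx)
    have h3 := norm_le_norm_add_norm_sub' (fderiv ℝ f x) (fderiv ℝ f t₀)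
    have h4 := mul_le_mul_of_nonneg_left h1 hH0
    linarith
  simpa using (convex_segment t₀ t).norm_image_sub_le_of_norm_fderiv_le
    (fun x hx => hd1 x (hsub hx)) hseg (left_mem_segment ℝ t₀ t) (right_mem_segment ℝ t₀ t)

/-! ### Strong law and passage to subsequences -/

theorem ae_tendsto_average {𝒳 Ω : Type*} [MeasurableSpace 𝒳] [MeasurableSpace Ω]
    {P : Measure Ω} {P₀ : Measure 𝒳} {X : ℕ → Ω → 𝒳} (hX : ∀ i, Measurable (X i))
    (hXlaw : ∀ i, P.map (X i) = P₀) (hXindep : iIndepFun X P) {f : 𝒳 → ℝ}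
    (hf : Integrable f P₀) :
    ∀ᵐ ω ∂P, Tendsto (fun n : ℕ => (n : ℝ)⁻¹ * ∑ i : Fin n, f (X i ω)) atTop
      (𝓝 (∫ x, f x ∂P₀)) := by
  have hfm : ∀ i, AEMeasurable f (P.map (X i)) := fun i => (hXlaw i).symm ▸ hf.aemeasurable
  have hint : Integrable (f ∘ X 0) P := by
    rw [← integrable_map_measure (by rw [hXlaw]; exact hf.aestronglyMeasurable) (hX 0).aemeasurable,
      hXlaw]
    exact hf
  have hlln := strong_law_ae_real (fun i => f ∘ X i) hint
    (fun i j hij => (hXindep.indepFun hij).comp₀ (hX i).aemeasurable (hX j).aemeasurable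
      (hfm i) (hfm j))
    (fun i => IdentDistrib.comp_of_aemeasurable
      ⟨(hX i).aemeasurable, (hX 0).aemeasurable, by rw [hXlaw, hXlaw]⟩ (hfm i))
  have hmean : P[f ∘ X 0] = ∫ x, f x ∂P₀ := by
    rw [← hXlaw 0, integral_map (hX 0).aemeasurable (by rw [hXlaw]; exact hf.aestronglyMeasurable)]
    rfl
  filter_upwards [hlln] with ω hω
  rw [hmean] at hω
  refine hω.congr fun n => ?_
  rw [← Fin.sum_univ_eq_sum_range (fun i => (f ∘ X i) ω) n, div_eq_inv_mul]
  rfl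

theorem exists_seq_forall_ae_tendsto {Ω ι : Type*} [MeasurableSpace Ω] {P : Measure Ω}
    {B : ι → ℕ → Ω → ℝ} (hB : ∀ i, TendstoInMeasure P (B i) atTop fun _ => 0) (ns : ℕ → ℕ)
    (hns : StrictMono ns) (s : Finset ι) :
    ∃ ns' : ℕ → ℕ, StrictMono ns' ∧
      ∀ i ∈ s, ∀ᵐ ω ∂P, Tendsto (fun k => B i (ns (ns' k)) ω) atTop (𝓝 0) := by
  classical
  induction s using Finset.induction_on with
  | empty => exact ⟨id, strictMono_id, by simp⟩
  | insert a s _ ih =>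
    obtain ⟨ns', h1, h2⟩ := ih
    obtain ⟨ns'', h3, h4⟩ := ((hB a).comp (hns.comp h1).tendsto_atTop).exists_seq_tendsto_ae
    refine ⟨ns' ∘ ns'', h1.comp h3, fun i hi => ?_⟩
    rcases Finset.mem_insert.1 hi with rfl | hi
    · exact h4
    · filter_upwards [h2 i hi] with ω hω
      exact hω.comp h3.tendsto_atTop

/-- Convergence in measure means that every subsequence has an almost surely convergent further
subsequence. Finitely many `B i` share one, and `l` is the image of `atTop` under it. -/
theorem tendstoInMeasure_of_forall_filter {Ω ι : Type*} [Finite ι] [MeasurableSpace Ω]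
    {P : Measure Ω} [IsFiniteMeasure P] {B : ι → ℕ → Ω → ℝ} {F : ℕ → Ω → ℝ}
    (hB : ∀ i, TendstoInMeasure P (B i) atTop fun _ => 0) (hF : ∀ n, Measurable (F n))
    (h : ∀ᵐ ω ∂P, ∀ l : Filter ℕ, l ≤ atTop →
      (∀ i, Tendsto (fun n => B i n ω) l (𝓝 0)) → Tendsto (fun n => F n ω) l (𝓝 0)) :
    TendstoInMeasure P F atTop fun _ => 0 := by
  have := Fintype.ofFinite ι
  rw [exists_seq_tendstoInMeasure_atTop_iff fun n => (hF n).aestronglyMeasurable]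
  intro ns hns
  obtain ⟨ns', h1, h2⟩ := exists_seq_forall_ae_tendsto hB ns hns Finset.univ
  refine ⟨ns', h1, ?_⟩
  have h3 : ∀ᵐ ω ∂P, ∀ i, Tendsto (fun k => B i (ns (ns' k)) ω) atTop (𝓝 0) :=
    ae_all_iff.2 fun i => h2 i (Finset.mem_univ i)
  filter_upwards [h, h3] with ω hω hω3
  have h4 := hω (map (ns ∘ ns') atTop) (hns.comp h1).tendsto_atTop fun i => tendsto_map'_iff.2 (hω3 i)
  exact tendsto_map'_iff.1 h4

/-! ### Sample moments at the estimated parameters -/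

theorem tendsto_average_mul {l : Filter ℕ} {a b : (n : ℕ) → Fin n → ℝ} {A : ℝ}
    (ha : Tendsto (fun n : ℕ => (n : ℝ)⁻¹ * ∑ i, a n i ^ 2) l (𝓝 A))
    (hb : Tendsto (fun n : ℕ => (n : ℝ)⁻¹ * ∑ i, b n i ^ 2) l (𝓝 0)) :
    Tendsto (fun n : ℕ => (n : ℝ)⁻¹ * ∑ i, a n i * b n i) l (𝓝 0) := by
  have h := ha.mul hb
  rw [mul_zero] at h
  have h2 : Tendsto (fun n : ℕ => ((n : ℝ)⁻¹ * ∑ i, a n i * b n i) ^ 2) l (𝓝 0) := by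
    refine squeeze_zero (fun n => sq_nonneg _) (fun n => ?_) h
    rw [mul_pow, mul_mul_mul_comm, ← sq]
    exact mul_le_mul_of_nonneg_left (Finset.sum_mul_sq_le_sq_mul_sq _ _ _) (sq_nonneg _)
  have h3 := h2.sqrt
  simp only [Real.sqrt_sq_eq_abs, Real.sqrt_zero] at h3
  exact tendsto_zero_iff_abs_tendsto_zero _ |>.2 h3

theorem sampleCov_apply {K n : ℕ} (hn : n ≠ 0) (z : Fin n → Fin K → ℝ) (j k : Fin K) :
    sampleCov z j k =
      (n : ℝ)⁻¹ * ∑ i, z i j * z i k - sampleMean z j * sampleMean z k := by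
  have hm : ∀ k, ∑ i, z i k = n * sampleMean z k := fun k => by
    simp only [sampleMean, Pi.smul_apply, Finset.sum_apply, smul_eq_mul]
    field_simp
  have hs : ∑ i, (z i j - sampleMean z j) * (z i k - sampleMean z k) =
      ∑ i, z i j * z i k - n * (sampleMean z j * sampleMean z k) := by
    simp only [sub_mul, mul_sub, Finset.sum_sub_distrib, ← Finset.mul_sum, ← Finset.sum_mul, hm,
      Finset.sum_const, Finset.card_univ, Fintype.card_fin, nsmul_eq_mul]
    ring
  rw [sampleCov, Matrix.smul_apply, Matrix.sum_apply]
  simp only [Matrix.vecMulVec_apply, Pi.sub_apply, smul_eq_mul]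
  rw [hs]
  field_simp

theorem tendsto_sampleMean {K : ℕ} {l : Filter ℕ} (hl : l ≤ atTop)
    {z y : (n : ℕ) → Fin n → Fin K → ℝ} {m : Fin K → ℝ}
    (hy : ∀ k, Tendsto (fun n : ℕ => (n : ℝ)⁻¹ * ∑ i, y n i k) l (𝓝 (m k)))
    (hd : ∀ k, Tendsto (fun n : ℕ => (n : ℝ)⁻¹ * ∑ i, (z n i k - y n i k) ^ 2) l (𝓝 0)) (k : Fin K) :
    Tendsto (fun n => sampleMean (z n) k) l (𝓝 (m k)) := by
  have h1 : Tendsto (fun n : ℕ => (n : ℝ)⁻¹ * ∑ _i : Fin n, (1 : ℝ) ^ 2) l (𝓝 1) := by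
    refine tendsto_const_nhds.congr' ?_
    filter_upwards [hl (eventually_ne_atTop 0)] with n hn
    have : (n : ℝ) ≠ 0 := by exact_mod_cast hn
    simp [this]
  have h := (hy k).add (tendsto_average_mul h1 (hd k))
  rw [add_zero] at h
  refine h.congr fun n => ?_
  simp only [sampleMean, Pi.smul_apply, Finset.sum_apply, smul_eq_mul, one_mul,
    Finset.sum_sub_distrib]
  ring

theorem tendsto_sampleCov {K : ℕ} {l : Filter ℕ} (hl : l ≤ atTop)
    {z y : (n : ℕ) → Fin n → Fin K → ℝ} {m : Fin K → ℝ} {E : Matrix (Fin K) (Fin K) ℝ}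
    (hy : ∀ k, Tendsto (fun n : ℕ => (n : ℝ)⁻¹ * ∑ i, y n i k) l (𝓝 (m k)))
    (hyy : ∀ j k, Tendsto (fun n : ℕ => (n : ℝ)⁻¹ * ∑ i, y n i j * y n i k) l (𝓝 (E j k)))
    (hd : ∀ k, Tendsto (fun n : ℕ => (n : ℝ)⁻¹ * ∑ i, (z n i k - y n i k) ^ 2) l (𝓝 0))
    (j k : Fin K) :
    Tendsto (fun n => sampleCov (z n) j k) l (𝓝 (E j k - m j * m k)) := by
  have hsq : ∀ k, Tendsto (fun n : ℕ => (n : ℝ)⁻¹ * ∑ i, y n i k ^ 2) l (𝓝 (E k k)) := fun k => by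
    simpa only [sq] using hyy k k
  -- With `z = y + (z - y)`, the product `z_j z_k` splits into `y_j y_k`, two cross terms and a
  -- product of errors; Cauchy–Schwarz removes all but the first.
  have h := (((hyy j k).add (tendsto_average_mul (hsq j) (hd k))).add
    (tendsto_average_mul (hsq k) (hd j))).add (tendsto_average_mul (hd j) (hd k))
  simp only [add_zero] at h
  have h2 := h.sub ((tendsto_sampleMean hl hy hd j).mul (tendsto_sampleMean hl hy hd k))
  refine h2.congr' ?_
  filter_upwards [hl (eventually_ne_atTop 0)] with n hn
  rw [sampleCov_apply hn, ← mul_add, ← mul_add, ← mul_add, ← Finset.sum_add_distrib,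
    ← Finset.sum_add_distrib, ← Finset.sum_add_distrib]
  congr 2
  exact Finset.sum_congr rfl fun i _ => by ring

/-- The loss comparison needs only `n^(1/4) ‖θ̂ - θ*‖ → 0` in probability. -/
theorem IsBigOInProb.tendstoInMeasure_sqrt_sqrt_mul {Ω : Type*} [MeasurableSpace Ω] {P : Measure Ω}
    {Y : ℕ → Ω → ℝ} (h : IsBigOInProb P Y fun n : ℕ => 1 / Real.sqrt n) :
    TendstoInMeasure P (fun (n : ℕ) ω => Real.sqrt (Real.sqrt n) * Y n ω) atTop fun _ => 0 := by
  have hs : Tendsto (fun n : ℕ => Real.sqrt (Real.sqrt n)) atTop atTop :=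
    Real.tendsto_sqrt_atTop.comp (Real.tendsto_sqrt_atTop.comp tendsto_natCast_atTop_atTop)
  rw [tendstoInMeasure_iff_norm]
  intro ε hε
  rw [ENNReal.tendsto_nhds_zero]
  intro δ hδ
  obtain ⟨M, hM⟩ := h δ hδ
  filter_upwards [hM, (tendsto_const_nhds.div_atTop hs : Tendsto (fun n : ℕ =>
    M / Real.sqrt (Real.sqrt n)) atTop (𝓝 0)).eventually_lt_const hε, eventually_gt_atTop 0]
    with n hn hn2 hn0
  refine (measure_mono fun ω hω => ?_).trans hn.le
  have hω' : ε ≤ ‖Real.sqrt (Real.sqrt n) * Y n ω - 0‖ := hω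
  have hpos : 0 < Real.sqrt (Real.sqrt n) := by positivity
  rw [sub_zero, Real.norm_eq_abs, abs_mul, abs_of_pos hpos] at hω'
  change M * (1 / Real.sqrt n) < |Y n ω|
  by_contra! hle
  have h2 := mul_le_mul_of_nonneg_left hle hpos.le
  have h3 : Real.sqrt (Real.sqrt n) * (M * (1 / Real.sqrt n)) = M / Real.sqrt (Real.sqrt n) := by
    have h4 : Real.sqrt n = Real.sqrt (Real.sqrt n) ^ 2 := (Real.sq_sqrt (Real.sqrt_nonneg _)).symm
    rw [h4, Real.sqrt_sq hpos.le]
    field_simp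
  linarith

/-- Applied to the Hessian bounds `H(X_i)`, this makes a first moment of `H` enough. -/
theorem sum_sq_le_sq_sum_of_nonneg {ι : Type*} [Fintype ι] {a : ι → ℝ} (ha : ∀ i, 0 ≤ a i) :
    ∑ i, a i ^ 2 ≤ (∑ i, a i) ^ 2 := by
  rw [sq, Finset.sum_mul]
  refine Finset.sum_le_sum fun i _ => ?_
  rw [sq]
  exact mul_le_mul_of_nonneg_left
    (Finset.single_le_sum (fun j _ => ha j) (Finset.mem_univ i)) (ha i)

/-- With `δ = ‖θ̂ - θ*‖`, the average is at most `2δ² · avg(g²) + 2 n δ⁴ · avg(H)²`. The factor `n`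
comes from bounding `∑ H²` by `(∑ H)²` and is absorbed by `n δ⁴ = (n^(1/4) δ)⁴`. -/
theorem tendsto_average_sq_loss_sub {𝒳 : Type*} {d : ℕ} {ℓ : 𝒳 → EuclideanSpace ℝ (Fin d) → ℝ}
    {t₀ : EuclideanSpace ℝ (Fin d)} {r : ℝ} (hr : 0 < r) {g H : 𝒳 → ℝ} (hH : ∀ x, 0 ≤ H x)
    (hℓ : ∀ x, ∀ t ∈ Metric.ball t₀ r,
      |ℓ x t - ℓ x t₀| ≤ (g x + H x * ‖t - t₀‖) * ‖t - t₀‖)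
    {l : Filter ℕ} (hl : l ≤ atTop) {x : ℕ → 𝒳} {t : ℕ → EuclideanSpace ℝ (Fin d)} {G h : ℝ}
    (hg : Tendsto (fun n : ℕ => (n : ℝ)⁻¹ * ∑ i : Fin n, g (x i) ^ 2) l (𝓝 G))
    (hh : Tendsto (fun n : ℕ => (n : ℝ)⁻¹ * ∑ i : Fin n, H (x i)) l (𝓝 h))
    (ht : Tendsto (fun n : ℕ => Real.sqrt (Real.sqrt n) * ‖t n - t₀‖) l (𝓝 0)) :
    Tendsto (fun n : ℕ => (n : ℝ)⁻¹ * ∑ i : Fin n, (ℓ (x i) (t n) - ℓ (x i) t₀) ^ 2) l (𝓝 0) := by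
  have hlim := (((ht.pow 2).const_mul 2).mul hg).add (((ht.pow 4).const_mul 2).mul (hh.pow 2))
  norm_num at hlim
  refine squeeze_zero' (Eventually.of_forall fun n => by positivity) ?_ hlim
  filter_upwards [hl (eventually_gt_atTop 0), ht.eventually_lt_const hr] with n hn hnr
  set s := Real.sqrt (Real.sqrt n)
  set δ := ‖t n - t₀‖
  have hδ : 0 ≤ δ := norm_nonneg _
  have hn1 : (1 : ℝ) ≤ n := by exact_mod_cast hn
  have hs : 1 ≤ s := Real.one_le_sqrt.2 (Real.one_le_sqrt.2 hn1)
  have hs4 : s ^ 4 = n := by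
    rw [show s ^ 4 = (s ^ 2) ^ 2 by ring, Real.sq_sqrt (Real.sqrt_nonneg _),
      Real.sq_sqrt (by positivity)]
  have hδs : δ ≤ s * δ := le_mul_of_one_le_left hδ hs
  have hball : t n ∈ Metric.ball t₀ r := by
    rw [mem_ball_iff_norm]; exact hδs.trans_lt hnr
  have hD : ∀ i : Fin n, (ℓ (x i) (t n) - ℓ (x i) t₀) ^ 2 ≤
      2 * δ ^ 2 * g (x i) ^ 2 + 2 * δ ^ 4 * H (x i) ^ 2 := by
    intro i
    have h1 := pow_le_pow_left₀ (abs_nonneg _) (hℓ (x i) (t n) hball) 2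
    rw [sq_abs] at h1
    refine h1.trans ?_
    -- This is the slack in `(a + b)² ≤ 2a² + 2b²`, multiplied by `δ²`.
    have h2 := mul_nonneg (sq_nonneg (g (x i) - H (x i) * δ)) (sq_nonneg δ)
    nlinarith [h2]
  have hsum := Finset.sum_le_sum fun i (_ : i ∈ Finset.univ) => hD i
  rw [Finset.sum_add_distrib, ← Finset.mul_sum, ← Finset.mul_sum] at hsum
  have hHs := sum_sq_le_sq_sum_of_nonneg fun i : Fin n => hH (x i)
  set SG := ∑ i : Fin n, g (x i) ^ 2
  have hSG : 0 ≤ SG := by positivity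
  set SH := ∑ i : Fin n, H (x i)
  calc (n : ℝ)⁻¹ * ∑ i : Fin n, (ℓ (x i) (t n) - ℓ (x i) t₀) ^ 2
      ≤ (n : ℝ)⁻¹ * (2 * δ ^ 2 * SG + 2 * δ ^ 4 * SH ^ 2) := by
        refine mul_le_mul_of_nonneg_left (hsum.trans ?_) (by positivity)
        gcongr
    _ = 2 * δ ^ 2 * ((n : ℝ)⁻¹ * SG) + 2 * (s * δ) ^ 4 * ((n : ℝ)⁻¹ * SH) ^ 2 := by
        rw [mul_pow s, hs4]
        field_simp
    _ ≤ 2 * (s * δ) ^ 2 * ((n : ℝ)⁻¹ * SG) + 2 * (s * δ) ^ 4 * ((n : ℝ)⁻¹ * SH) ^ 2 := by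
        gcongr

/-! ### The posterior scale matrix and its limit -/

/-- The scale matrix `Ψ_n` of the posterior. -/
noncomputable def posteriorScale {K : ℕ} (m0 : Fin K → ℝ) (lam0 : ℝ)
    (Psi0 : Matrix (Fin K) (Fin K) ℝ) {n : ℕ} (z : Fin n → Fin K → ℝ) :
    Matrix (Fin K) (Fin K) ℝ :=
  Psi0 + (n : ℝ) • sampleCov z +
    (lam0 * n / (lam0 + n)) • Matrix.vecMulVec (sampleMean z - m0) (sampleMean z - m0)

theorem niwPosterior_eq {K : ℕ} (m0 : Fin K → ℝ) (lam0 : ℝ) (Psi0 : Matrix (Fin K) (Fin K) ℝ)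
    (nu0 : ℝ) {n : ℕ} (z : Fin n → Fin K → ℝ) :
    niwPosterior m0 lam0 Psi0 nu0 z =
      niw ((lam0 + n)⁻¹ • (lam0 • m0 + (n : ℝ) • sampleMean z)) (lam0 + n)
        (posteriorScale m0 lam0 Psi0 z) (nu0 + n) := rfl

theorem posDef_posteriorScale {K : ℕ} (m0 : Fin K → ℝ) {lam0 : ℝ} (hlam0 : 0 < lam0)
    {Psi0 : Matrix (Fin K) (Fin K) ℝ} (hPsi0 : Psi0.PosDef) {n : ℕ} (z : Fin n → Fin K → ℝ) :
    (posteriorScale m0 lam0 Psi0 z).PosDef := by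
  have hv : ∀ a : Fin K → ℝ, (Matrix.vecMulVec a a).PosSemidef := fun a => by
    simpa using Matrix.posSemidef_vecMulVec_self_star a
  refine (hPsi0.add_posSemidef ?_).add_posSemidef ((hv _).smul (by positivity))
  refine Matrix.PosSemidef.smul (Matrix.PosSemidef.smul ?_ (by positivity)) (by positivity)
  exact Matrix.posSemidef_sum _ fun i _ => hv _

theorem measurable_posteriorScale {K : ℕ} (m0 : Fin K → ℝ) (lam0 : ℝ)
    (Psi0 : Matrix (Fin K) (Fin K) ℝ) (n : ℕ) :
    Measurable fun z : Fin n → Fin K → ℝ => posteriorScale m0 lam0 Psi0 z := by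
  have hm : Continuous fun z : Fin n → Fin K → ℝ => sampleMean z := by
    unfold sampleMean
    exact (continuous_finsetSum _ fun i _ => continuous_apply i).const_smul (n : ℝ)⁻¹
  refine Continuous.measurable ?_
  unfold posteriorScale sampleCov
  refine (continuous_const.add (Continuous.const_smul
    (Continuous.const_smul (continuous_finsetSum _ fun i _ => ?_) (n : ℝ)⁻¹) (n : ℝ))).add
    (Continuous.const_smul ?_ (lam0 * n / (lam0 + n)))
  · exact Continuous.matrix_vecMulVec ((continuous_apply i).sub hm) ((continuous_apply i).sub hm)
  · exact Continuous.matrix_vecMulVec (hm.sub continuous_const) (hm.sub continuous_const)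

theorem tendsto_matrix {ι m n : Type*} {l : Filter ι} {M : ι → Matrix m n ℝ} {L : Matrix m n ℝ}
    (h : ∀ i j, Tendsto (fun a => M a i j) l (𝓝 (L i j))) : Tendsto M l (𝓝 L) :=
  tendsto_pi_nhds.2 fun i => tendsto_pi_nhds.2 fun j => h i j

theorem tendsto_matrix_inv {ι n : Type*} [Fintype n] [DecidableEq n] {l : Filter ι}
    {M : ι → Matrix n n ℝ} {L : Matrix n n ℝ} (hL : L.det ≠ 0) (h : Tendsto M l (𝓝 L)) :
    Tendsto (fun a => (M a)⁻¹) l (𝓝 L⁻¹) := by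
  refine (continuousAt_matrix_inv L ?_).tendsto.comp h
  rw [Ring.inverse_eq_inv']
  exact continuousAt_inv₀ hL

theorem tendsto_inv_smul_posteriorScale {K : ℕ} (m0 : Fin K → ℝ) (lam0 : ℝ)
    (Psi0 : Matrix (Fin K) (Fin K) ℝ) (nu0 : ℝ) {l : Filter ℕ} (hl : l ≤ atTop)
    {z : (n : ℕ) → Fin n → Fin K → ℝ} {m : Fin K → ℝ} {S : Matrix (Fin K) (Fin K) ℝ}
    (hm : ∀ k, Tendsto (fun n => sampleMean (z n) k) l (𝓝 (m k)))
    (hS : ∀ j k, Tendsto (fun n => sampleCov (z n) j k) l (𝓝 (S j k))) :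
    Tendsto (fun n : ℕ => (nu0 + n)⁻¹ • posteriorScale m0 lam0 Psi0 (z n)) l (𝓝 S) := by
  have hnat : Tendsto (fun n : ℕ => (n : ℝ)) l atTop := tendsto_natCast_atTop_atTop.mono_left hl
  have hinv : ∀ a : ℝ, Tendsto (fun n : ℕ => (a + n)⁻¹) l (𝓝 0) := fun a =>
    (tendsto_atTop_add_const_left _ _ hnat).inv_tendsto_atTop
  have hratio : ∀ a : ℝ, Tendsto (fun n : ℕ => (a + n)⁻¹ * n) l (𝓝 1) := fun a => by
    have h := ((hinv a).const_mul a).const_sub 1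
    rw [mul_zero, sub_zero] at h
    refine h.congr' ?_
    filter_upwards [(tendsto_atTop_add_const_left _ a hnat).eventually_gt_atTop 0] with n hn
    field_simp
    ring
  refine tendsto_matrix fun j k => ?_
  -- Only the sample covariance survives: `Ψ₀ / ν_n → 0`, and the rank-one term has the bounded
  -- coefficient `λ₀ n / λ_n`.
  have h := (((hinv nu0).mul_const (Psi0 j k)).add ((hratio nu0).mul (hS j k))).add
    ((((hinv nu0).mul ((hratio lam0).const_mul lam0))).mul
      (((hm j).sub_const (m0 j)).mul ((hm k).sub_const (m0 k))))
  simp only [zero_mul, one_mul, zero_add, add_zero] at h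
  refine h.congr fun n => ?_
  simp only [posteriorScale, Matrix.smul_apply, Matrix.add_apply, Matrix.vecMulVec_apply,
    Pi.sub_apply, smul_eq_mul]
  ring

/-! ### Matrix limits from quadratic forms -/

theorem quadForm_single_add_single {K : ℕ} (M : Matrix (Fin K) (Fin K) ℝ) (i j : Fin K) :
    (Pi.single i 1 + Pi.single j 1) ⬝ᵥ (M.mulVec (Pi.single i 1 + Pi.single j 1)) =
      M i i + M i j + M j i + M j j := by
  simp only [Matrix.mulVec_add, add_dotProduct, dotProduct_add, Matrix.mulVec_single_one,
    single_one_dotProduct, Matrix.col_apply]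
  ring

theorem tendsto_of_quadForm {K : ℕ} {ι : Type*} {l : Filter ι}
    {M : ι → Matrix (Fin K) (Fin K) ℝ} {L : Matrix (Fin K) (Fin K) ℝ} (hM : ∀ a, (M a).IsSymm)
    (hL : L.IsSymm)
    (h : ∀ i j : Fin K, Tendsto (fun a => (Pi.single i 1 + Pi.single j 1) ⬝ᵥ
      ((M a).mulVec (Pi.single i 1 + Pi.single j 1))) l
      (𝓝 ((Pi.single i 1 + Pi.single j 1) ⬝ᵥ (L.mulVec (Pi.single i 1 + Pi.single j 1))))) :
    Tendsto M l (𝓝 L) := by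
  simp only [quadForm_single_add_single] at h
  refine tendsto_matrix fun i j => ?_
  -- Polarization; for `i = j` the vector is `2 e_i`, whose form is `4 N i i`, hence the factors `1
  -- / 4`.
  have key : ∀ N : Matrix (Fin K) (Fin K) ℝ, N.IsSymm → N i j =
      1 / 2 * ((N i i + N i j + N j i + N j j) - 1 / 4 * (N i i + N i i + N i i + N i i) -
        1 / 4 * (N j j + N j j + N j j + N j j)) := fun N hN => by
    rw [hN.apply i j]; ring
  rw [key L hL]
  refine Tendsto.congr (fun a => (key (M a) (hM a)).symm) ?_
  exact (((h i j).sub ((h i i).const_mul _)).sub ((h j j).const_mul _)).const_mul _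

theorem tendsto_frobNorm_sub {ι m n : Type*} [Fintype m] [Fintype n] {l : Filter ι}
    {M : ι → Matrix m n ℝ} {L : Matrix m n ℝ} (h : Tendsto M l (𝓝 L)) :
    Tendsto (fun a => frobNorm (M a - L)) l (𝓝 0) := by
  have h1 : ∀ i j, Tendsto (fun a => M a i j) l (𝓝 (L i j)) := fun i j =>
    tendsto_pi_nhds.1 (tendsto_pi_nhds.1 h i) j
  have h2 := (tendsto_finsetSum Finset.univ fun i _ => tendsto_finsetSum Finset.univ fun j _ =>
    ((h1 i j).sub_const (L i j)).pow 2).sqrt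
  simpa [frobNorm] using h2

theorem measurable_frobNorm_sub {m n : Type*} [Fintype m] [Fintype n] (L : Matrix m n ℝ) :
    Measurable fun M : Matrix m n ℝ => frobNorm (M - L) :=
  (Finset.measurable_sum _ fun i _ => Finset.measurable_sum _ fun j _ =>
    ((measurable_matrix_apply i j).sub_const (L i j)).pow_const 2).sqrt

/-! ### The posterior draw -/

/-- Disintegration of the joint law: a conditional bound uniform in the data passes to the joint
probability. -/
theorem measure_le_of_condDistrib_le {Ω α β : Type*} [MeasurableSpace Ω] [MeasurableSpace α]
    [MeasurableSpace β] [StandardBorelSpace β] [Nonempty β] {P : Measure Ω} [IsProbabilityMeasure P]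
    {Z : Ω → α} {Y : Ω → β} (hZ : Measurable Z) (hY : Measurable Y) {B : Set (α × β)}
    (hB : MeasurableSet B) {c : ENNReal}
    (h : ∀ᵐ ω ∂P, condDistrib Y Z P (Z ω) {y | (Z ω, y) ∈ B} ≤ c) :
    P {ω | (Z ω, Y ω) ∈ B} ≤ c := by
  have h1 : P {ω | (Z ω, Y ω) ∈ B} = (P.map Z ⊗ₘ condDistrib Y Z P) B := by
    rw [compProd_map_condDistrib hY.aemeasurable, Measure.map_apply (hZ.prodMk hY) hB]
    rfl
  rw [h1, Measure.compProd_apply hB,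
    lintegral_map (Kernel.measurable_kernel_prodMk_left hB) hZ]
  calc ∫⁻ ω, condDistrib Y Z P (Z ω) (Prod.mk (Z ω) ⁻¹' B) ∂P ≤ ∫⁻ _, c ∂P := lintegral_mono_ae h
    _ = c := by simp

section PosteriorDraw

variable {Ω : Type*} [MeasurableSpace Ω] {P : Measure Ω} [IsProbabilityMeasure P] {K : ℕ}
  {m0 : Fin K → ℝ} {lam0 nu0 : ℝ} {Psi0 : Matrix (Fin K) (Fin K) ℝ}
  {Z : (n : ℕ) → Ω → Fin n → Fin K → ℝ} {mu' : ℕ → Ω → Fin K → ℝ}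
  {Sigma' : ℕ → Ω → Matrix (Fin K) (Fin K) ℝ}

theorem ae_posDef_of_condDistrib_eq_niwPosterior (hZ : ∀ n, Measurable (Z n))
    (hmu' : ∀ n, Measurable (mu' n)) (hSigma' : ∀ n, Measurable (Sigma' n))
    (hdraw : ∀ n, 1 ≤ n → ∀ᵐ ω ∂P,
      condDistrib (fun ω => (mu' n ω, Sigma' n ω)) (Z n) P (Z n ω) =
        niwPosterior m0 lam0 Psi0 nu0 (Z n ω)) {n : ℕ} (hn : 1 ≤ n) :
    ∀ᵐ ω ∂P, (Sigma' n ω).PosDef := by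
  rw [ae_iff, ← nonpos_iff_eq_zero]
  refine measure_le_of_condDistrib_le (hZ n) ((hmu' n).prodMk (hSigma' n))
    (B := {p | ¬ p.2.2.PosDef}) (measurable_snd.comp measurable_snd measurableSet_posDef).compl ?_
  filter_upwards [hdraw n hn] with ω hω
  rw [hω, niwPosterior_eq]
  exact le_of_eq (ae_iff.1 (ae_niw_posDef _ _ _ _))

theorem tendstoInMeasure_posterior_quadForm (hlam0 : 0 < lam0) (hPsi0 : Psi0.PosDef)
    (hnu0 : -1 < nu0) (hZ : ∀ n, Measurable (Z n))
    (hmu' : ∀ n, Measurable (mu' n)) (hSigma' : ∀ n, Measurable (Sigma' n))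
    (hdraw : ∀ n, 1 ≤ n → ∀ᵐ ω ∂P,
      condDistrib (fun ω => (mu' n ω, Sigma' n ω)) (Z n) P (Z n ω) =
        niwPosterior m0 lam0 Psi0 nu0 (Z n ω)) {v : Fin K → ℝ} (hv : v ≠ 0) :
    TendstoInMeasure P (fun (n : ℕ) ω => (v ⬝ᵥ ((Sigma' n ω)⁻¹.mulVec v)) /
      ((nu0 + n) * (v ⬝ᵥ ((posteriorScale m0 lam0 Psi0 (Z n ω))⁻¹.mulVec v))) - 1) atTop
      fun _ => 0 := by
  rw [tendstoInMeasure_iff_norm]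
  intro ε hε
  obtain ⟨c, hc, hconc⟩ := exists_niw_concentration hε
  have hlim : Tendsto (fun n : ℕ => ENNReal.ofReal (2 * Real.exp (-c * (nu0 + n)))) atTop
      (𝓝 0) := by
    have h := (Real.tendsto_exp_atBot.comp ((tendsto_atTop_add_const_left _ nu0
      tendsto_natCast_atTop_atTop).const_mul_atTop_of_neg (neg_lt_zero.2 hc))).const_mul 2
    simpa using ENNReal.tendsto_ofReal h
  refine tendsto_of_tendsto_of_tendsto_of_le_of_le' tendsto_const_nhds hlim
    (Eventually.of_forall fun n => zero_le) ?_
  filter_upwards [eventually_ge_atTop 1] with n hn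
  have hn' : (1 : ℝ) ≤ n := by exact_mod_cast hn
  simp only [sub_zero, Real.norm_eq_abs]
  have hmeas : Measurable fun p : (Fin n → Fin K → ℝ) × (Fin K → ℝ) × Matrix (Fin K) (Fin K) ℝ =>
      |(v ⬝ᵥ (p.2.2⁻¹.mulVec v)) /
        ((nu0 + n) * (v ⬝ᵥ ((posteriorScale m0 lam0 Psi0 p.1)⁻¹.mulVec v))) - 1| := by
    have h1 : Measurable fun p : (Fin n → Fin K → ℝ) × (Fin K → ℝ) × Matrix (Fin K) (Fin K) ℝ =>
        v ⬝ᵥ (p.2.2⁻¹.mulVec v) :=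
      (measurable_inv_quadForm v).comp (measurable_snd.comp measurable_snd)
    have h2 : Measurable fun p : (Fin n → Fin K → ℝ) × (Fin K → ℝ) × Matrix (Fin K) (Fin K) ℝ =>
        (nu0 + n) * (v ⬝ᵥ ((posteriorScale m0 lam0 Psi0 p.1)⁻¹.mulVec v)) :=
      ((measurable_inv_quadForm v).comp
        ((measurable_posteriorScale m0 lam0 Psi0 n).comp measurable_fst)).const_mul _
    exact ((h1.div h2).sub_const 1).abs
  refine measure_le_of_condDistrib_le (hZ n) ((hmu' n).prodMk (hSigma' n))
    (B := {p | ε ≤ |(v ⬝ᵥ (p.2.2⁻¹.mulVec v)) /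
        ((nu0 + n) * (v ⬝ᵥ ((posteriorScale m0 lam0 Psi0 p.1)⁻¹.mulVec v))) - 1|})
    (measurableSet_le measurable_const hmeas) ?_
  filter_upwards [hdraw n hn] with ω hω
  -- A regular conditional distribution is a probability measure, which supplies the normalisation.
  have hprob : niwPosterior m0 lam0 Psi0 nu0 (Z n ω) Set.univ = 1 := by
    rw [← hω]; exact measure_univ
  rw [hω]
  rw [niwPosterior_eq] at hprob ⊢
  exact hconc K _ _ _ _ v (posDef_posteriorScale m0 hlam0 hPsi0 _) (by positivity) (by linarith)
    hv hprob

end PosteriorDraw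

theorem single_add_single_ne_zero {K : ℕ} (i j : Fin K) :
    (Pi.single i 1 + Pi.single j 1 : Fin K → ℝ) ≠ 0 := fun h => by
  have h1 := congrFun h i
  by_cases hij : i = j
  · subst hij; norm_num at h1
  · simp [hij] at h1

theorem tendsto_of_posterior_quadForm {K : ℕ} {l : Filter ℕ} {S : Matrix (Fin K) (Fin K) ℝ}
    (hS : S.PosDef) {Psi Sig : ℕ → Matrix (Fin K) (Fin K) ℝ} {nu : ℕ → ℝ}
    (hnu : ∀ᶠ n in l, 0 < nu n) (hPsi : ∀ n, (Psi n).PosDef) (hSig : ∀ᶠ n in l, (Sig n).PosDef)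
    (hlim : Tendsto (fun n => (nu n)⁻¹ • Psi n) l (𝓝 S))
    (hratio : ∀ i j : Fin K, Tendsto (fun n =>
      ((Pi.single i 1 + Pi.single j 1) ⬝ᵥ ((Sig n)⁻¹.mulVec (Pi.single i 1 + Pi.single j 1))) /
      (nu n * ((Pi.single i 1 + Pi.single j 1) ⬝ᵥ
        ((Psi n)⁻¹.mulVec (Pi.single i 1 + Pi.single j 1)))) - 1) l (𝓝 0)) :
    Tendsto Sig l (𝓝 S) := by
  classical
  have hinv := tendsto_matrix_inv hS.det_pos.ne' hlim
  have hsymm : ∀ {M : Matrix (Fin K) (Fin K) ℝ}, M.PosDef → M.IsSymm := fun h => by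
    simpa using h.isHermitian
  -- Polarization is applied to matrices symmetric at every index, so the identity stands in where
  -- `Sig n` is not positive definite; this does not affect the limit along `l`.
  set T : ℕ → Matrix (Fin K) (Fin K) ℝ := fun n => if (Sig n).PosDef then (Sig n)⁻¹ else 1
  have hT : Tendsto T l (𝓝 S⁻¹) := by
    refine tendsto_of_quadForm (fun n => ?_) (hsymm hS.inv) fun i j => ?_
    · simp only [T]
      split_ifs with h
      · exact hsymm h.inv
      · exact Matrix.isSymm_one
    · have hr := hratio i j
      have hv := single_add_single_ne_zero i j
      generalize (Pi.single i 1 + Pi.single j 1 : Fin K → ℝ) = v at hr hv ⊢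
      have hQ : Tendsto (fun n => v ⬝ᵥ (((nu n)⁻¹ • Psi n)⁻¹.mulVec v)) l
          (𝓝 (v ⬝ᵥ (S⁻¹.mulVec v))) :=
        ((Continuous.dotProduct continuous_const (Continuous.matrix_mulVec continuous_id
          continuous_const)).tendsto S⁻¹).comp hinv
      have h := (hr.add_const 1).mul hQ
      rw [zero_add, one_mul] at h
      refine h.congr' ?_
      filter_upwards [hnu, hSig] with n hn hSn
      have hq : 0 < v ⬝ᵥ ((Psi n)⁻¹.mulVec v) := by
        simpa using (hPsi n).inv.dotProduct_mulVec_pos hv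
      have hinvsmul : ((nu n)⁻¹ • Psi n)⁻¹ = nu n • (Psi n)⁻¹ := by
        refine Matrix.inv_eq_right_inv ?_
        rw [Matrix.smul_mul, Matrix.mul_smul, smul_smul, inv_mul_cancel₀ hn.ne', one_smul,
          Matrix.mul_nonsing_inv _ (hPsi n).det_pos.ne'.isUnit]
      simp only [T, hSn, if_true, hinvsmul, Matrix.smul_mulVec, dotProduct_smul, smul_eq_mul]
      rw [sub_add_cancel]
      field_simp
  have h := tendsto_matrix_inv hS.inv.det_pos.ne' hT
  rw [Matrix.nonsing_inv_nonsing_inv _ hS.det_pos.ne'.isUnit] at h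
  refine h.congr' ?_
  filter_upwards [hSig] with n hSn
  simp only [T, hSn, if_true]
  exact Matrix.nonsing_inv_nonsing_inv _ hSn.det_pos.ne'.isUnit

/-! ### Assembly for the models -/

section Models

variable {𝒳 Ω : Type*} [MeasurableSpace 𝒳] [MeasurableSpace Ω] {P : Measure Ω} {P₀ : Measure 𝒳}
  {X : ℕ → Ω → 𝒳}

theorem ModelRegularity.measurable_loss_comp {d : ℕ} {Θ : Set (EuclideanSpace ℝ (Fin d))}
    {ℓ : 𝒳 → EuclideanSpace ℝ (Fin d) → ℝ} {tstar : EuclideanSpace ℝ (Fin d)}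
    {that : (n : ℕ) → (Fin n → 𝒳) → EuclideanSpace ℝ (Fin d)}
    (h : ModelRegularity P P₀ X Θ ℓ tstar that) {α : Type*} [MeasurableSpace α] {x : α → 𝒳}
    {t : α → EuclideanSpace ℝ (Fin d)} (hx : Measurable x) (ht : Measurable t)
    (htΘ : ∀ a, t a ∈ Θ) : Measurable fun a => ℓ (x a) (t a) :=
  h.measurable_loss.comp (hx.prodMk (ht.subtype_mk (h := htΘ)))

theorem ModelRegularity.ae_tendsto_average_sq {d : ℕ} {Θ : Set (EuclideanSpace ℝ (Fin d))}
    {ℓ : 𝒳 → EuclideanSpace ℝ (Fin d) → ℝ} {tstar : EuclideanSpace ℝ (Fin d)}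
    {that : (n : ℕ) → (Fin n → 𝒳) → EuclideanSpace ℝ (Fin d)}
    (h : ModelRegularity P P₀ X Θ ℓ tstar that) (hX : ∀ i, Measurable (X i))
    (hXlaw : ∀ i, P.map (X i) = P₀) (hXindep : iIndepFun X P) :
    ∀ᵐ ω ∂P, ∀ l : Filter ℕ, l ≤ atTop →
      Tendsto (fun n : ℕ => Real.sqrt (Real.sqrt n) * ‖that n (fun i => X i ω) - tstar‖) l (𝓝 0) →
      Tendsto (fun n : ℕ => (n : ℝ)⁻¹ * ∑ i : Fin n,
        (ℓ (X i ω) (that n fun i => X i ω) - ℓ (X i ω) tstar) ^ 2) l (𝓝 0) := by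
  obtain ⟨r, hr, -, -, hdiff, H, hH0, hHint, hH⟩ := h.local_regularity
  have h1 := ae_tendsto_average hX hXlaw hXindep h.gradient_sq_integrable
  have h2 := ae_tendsto_average hX hXlaw hXindep hHint
  filter_upwards [h1, h2] with ω h1 h2 l hl ht
  have h3 := fun x t htb => abs_sub_le_of_hessian_le (t := t) (hdiff x) (hH x) htb
  have h4 := tendsto_average_sq_loss_sub (x := fun i => X i ω) (t := fun n => that n fun i => X i ω)
    (g := fun x => ‖gradient (ℓ x) tstar‖) hr hH0 h3 hl (h1.mono_left hl) (h2.mono_left hl) ht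
  exact h4

end Models

theorem mainTheorem8 {𝒳 Ω : Type*} [MeasurableSpace 𝒳] [MeasurableSpace Ω]
    (P : Measure Ω) [IsProbabilityMeasure P] (P₀ : Measure 𝒳) [IsProbabilityMeasure P₀]
    -- the observations are i.i.d. with distribution `P₀`
    (X : ℕ → Ω → 𝒳) (hX : ∀ i, Measurable (X i)) (hXlaw : ∀ i, P.map (X i) = P₀)
    (hXindep : iIndepFun X P)
    -- the models
    (K : ℕ) (d : Fin K → ℕ) (Θ : (k : Fin K) → Set (EuclideanSpace ℝ (Fin (d k))))
    (ℓ : (k : Fin K) → 𝒳 → EuclideanSpace ℝ (Fin (d k)) → ℝ)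
    (tstar : (k : Fin K) → EuclideanSpace ℝ (Fin (d k)))
    (that : (k : Fin K) → (n : ℕ) → (Fin n → 𝒳) → EuclideanSpace ℝ (Fin (d k)))
    -- finite second moments and positive definite covariance
    (hmoment : ∀ k, Integrable (fun x => ℓ k x (tstar k) ^ 2) P₀)
    (hposdef : (ladCovariance P₀ ℓ tstar).PosDef)
    -- regularity of each model and root-n consistency of its estimator
    (hreg : ∀ k, ModelRegularity P P₀ X (Θ k) (ℓ k) (tstar k) (that k))
    -- hyperparameters of the prior
    (m0 : Fin K → ℝ) (lam0 : ℝ) (hlam0 : 0 < lam0)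
    (Psi0 : Matrix (Fin K) (Fin K) ℝ) (hPsi0 : Psi0.PosDef) (nu0 : ℝ) (hnu0 : (K : ℝ) - 1 < nu0)
    -- for each sample size, a draw `(μ', Σ')` from the posterior given `Z_1, …, Z_n`
    (mu' : ℕ → Ω → Fin K → ℝ) (Sigma' : ℕ → Ω → Matrix (Fin K) (Fin K) ℝ)
    (hmu' : ∀ n, Measurable (mu' n)) (hSigma' : ∀ n, Measurable (Sigma' n))
    (hdraw : ∀ n, 1 ≤ n → ∀ᵐ ω ∂P,
      condDistrib (fun ω => (mu' n ω, Sigma' n ω))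
          (fun ω => ladVectors ℓ that (fun i : Fin n => X i ω)) P
          (ladVectors ℓ that (fun i : Fin n => X i ω)) =
        niwPosterior m0 lam0 Psi0 nu0 (ladVectors ℓ that (fun i : Fin n => X i ω))) :
    TendstoInMeasure P (fun n ω => frobNorm (Sigma' n ω - ladCovariance P₀ ℓ tstar)) atTop
      (fun _ => 0) := by
  have hZ : ∀ n, Measurable fun ω => ladVectors ℓ that (fun i : Fin n => X i ω) := fun n => by
    have hXn : Measurable fun ω => fun i : Fin n => X i ω :=
      measurable_pi_lambda _ fun i => hX i
    exact measurable_pi_lambda _ fun i => measurable_pi_lambda _ fun k =>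
      (hreg k).measurable_loss_comp (hX i) (((hreg k).measurable_estimator n).comp hXn)
        fun ω => (hreg k).estimator_mem n _
  have hnu : -1 < nu0 := by
    have : (0 : ℝ) ≤ K := K.cast_nonneg
    linarith
  have hmemLp : ∀ k, MemLp (fun x => ℓ k x (tstar k)) 2 P₀ := fun k =>
    (memLp_two_iff_integrable_sq ((hreg k).measurable_loss_comp measurable_id measurable_const
      fun _ => (hreg k).mem_argmin.1).aestronglyMeasurable).2 (hmoment k)
  have hmean : ∀ᵐ ω ∂P, ∀ k, Tendsto (fun n : ℕ => (n : ℝ)⁻¹ * ∑ i : Fin n, ℓ k (X i ω) (tstar k))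
      atTop (𝓝 (∫ x, ℓ k x (tstar k) ∂P₀)) := ae_all_iff.2 fun k =>
    ae_tendsto_average hX hXlaw hXindep ((hmemLp k).integrable one_le_two)
  have hprod : ∀ᵐ ω ∂P, ∀ j k, Tendsto (fun n : ℕ => (n : ℝ)⁻¹ *
      ∑ i : Fin n, ℓ j (X i ω) (tstar j) * ℓ k (X i ω) (tstar k))
      atTop (𝓝 (∫ x, ℓ j x (tstar j) * ℓ k x (tstar k) ∂P₀)) :=
    ae_all_iff.2 fun j => ae_all_iff.2 fun k =>
      ae_tendsto_average hX hXlaw hXindep ((hmemLp j).integrable_mul (hmemLp k))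
  have hsq := ae_all_iff.2 fun k => (hreg k).ae_tendsto_average_sq hX hXlaw hXindep
  have hpd : ∀ᵐ ω ∂P, ∀ n, 1 ≤ n → (Sigma' n ω).PosDef := ae_all_iff.2 fun n => by
    by_cases hn : 1 ≤ n
    · filter_upwards [ae_posDef_of_condDistrib_eq_niwPosterior hZ hmu' hSigma' hdraw hn]
        with ω hω _ using hω
    · exact Eventually.of_forall fun ω h => absurd h hn
  have hcov : ∀ j k, ladCovariance P₀ ℓ tstar j k = ∫ x, ℓ j x (tstar j) * ℓ k x (tstar k) ∂P₀ -
      (∫ x, ℓ j x (tstar j) ∂P₀) * ∫ x, ℓ k x (tstar k) ∂P₀ := fun j k =>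
    covariance_eq_sub (hmemLp j) (hmemLp k)
  -- Two finite families converge in probability: the scaled estimation errors, indexed by `k`, and
  -- the quadratic-form ratios, indexed by pairs `(i, j)`.
  refine tendstoInMeasure_of_forall_filter (ι := Fin K ⊕ Fin K × Fin K)
    (B := Sum.elim
      (fun k n ω => Real.sqrt (Real.sqrt n) * ‖that k n (fun i => X i ω) - tstar k‖)
      (fun p n ω => ((Pi.single p.1 1 + Pi.single p.2 1) ⬝ᵥ
          ((Sigma' n ω)⁻¹.mulVec (Pi.single p.1 1 + Pi.single p.2 1))) /
        ((nu0 + n) * ((Pi.single p.1 1 + Pi.single p.2 1) ⬝ᵥ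
          ((posteriorScale m0 lam0 Psi0 (ladVectors ℓ that fun i : Fin n => X i ω))⁻¹.mulVec
            (Pi.single p.1 1 + Pi.single p.2 1)))) - 1))
    ?_ (fun n => (measurable_frobNorm_sub _).comp (hSigma' n)) ?_
  · rintro (k | p)
    · exact (hreg k).estimator_rate.tendstoInMeasure_sqrt_sqrt_mul
    · exact tendstoInMeasure_posterior_quadForm hlam0 hPsi0 hnu hZ hmu' hSigma' hdraw
        (single_add_single_ne_zero _ _)
  · filter_upwards [hmean, hprod, hsq, hpd] with ω hω1 hω2 hω3 hω4 l hl hB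
    have hd := fun k => hω3 k l hl (hB (Sum.inl k))
    have hy := fun k => (hω1 k).mono_left hl
    have hm := tendsto_sampleMean hl
      (z := fun n => ladVectors ℓ that fun i : Fin n => X i ω)
      (y := fun n i k => ℓ k (X i ω) (tstar k)) hy hd
    have hS := tendsto_sampleCov hl
      (z := fun n => ladVectors ℓ that fun i : Fin n => X i ω)
      (y := fun n i k => ℓ k (X i ω) (tstar k))
      (E := Matrix.of fun j k => ∫ x, ℓ j x (tstar j) * ℓ k x (tstar k) ∂P₀) hy
      (fun j k => (hω2 j k).mono_left hl) hd
    have hlim := tendsto_inv_smul_posteriorScale m0 lam0 Psi0 nu0 hl hm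
      (S := ladCovariance P₀ ℓ tstar) fun j k => by rw [hcov]; exact hS j k
    refine tendsto_frobNorm_sub (tendsto_of_posterior_quadForm hposdef ?_
      (fun n => posDef_posteriorScale m0 hlam0 hPsi0 _) ?_ hlim fun i j => hB (Sum.inr (i, j)))
    · filter_upwards [hl (eventually_ge_atTop 1)] with n hn
      have hn' : (1 : ℝ) ≤ n := by exact_mod_cast hn
      linarith
    · filter_upwards [hl (eventually_ge_atTop 1)] with n hn using hω4 n hn
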